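/- **Setting.** Let $\mathcal P=[p_l,p_h]$ with $0<p_l<p_h$. For a parameter $\beta=(\mathbf a,\mathbf b)\in\mathbb R^2\times\mathbb R^2$ and a price $p\in\mathcal P$, let $D(p)$ and $C(p)>0$ be the random demand and the random total claims of one period, independent of each other for given $p$, with $$\mathbb E[D(p)]=h_1(a_0+a_1p),\quad \mathrm{Var}(D(p))=\sigma_1^2v_1(\mathbb E[D(p)]),\quad \mathbb E[\log C(p)]=h_2(b_0+b_1p),\quad \mathrm{Var}(\log C(p))=\sigma_2^2v_2(\mathbb E[\log C(p)]),$$ and $\mathbb E[C(p)]<\infty$, where $\sigma_i>0$, $h_i,v_i:\mathbb R\to\mathbb R$ are twice continuously differentiable, $v_i(h_i(x))>0$, and the links are canonical: $\dot h_i=v_i\circ h_i$. Put $r(p,\beta)=\mathbb E_\beta[pD(p)-C(p)]$, and let $p(\beta)\in\mathcal P$ be a maximizer of $r(\cdot,\beta)$ over $\mathcal P$ (an arbitrary element of $\mathcal P$ if there is none). Let $\beta_0$ be the true parameter and $p^*=p(\beta_0)$. Assume that there is an open bounded neighbourhood $V$ of $\beta_0$ such that for every $\beta\in V$ the maximizer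 of $r(\cdot,\beta)$ over $\mathcal P$ is unique, that $r$ is twice continuously differentiable on $\mathcal P\times V$, and that $\partial_p r(p^*,\beta_0)=0$ and $\partial_p^2 r(p^*,\beta_0)<0$ (one-sided derivatives if $p^*$ is an end point of $\mathcal P$). In periods $t=1,2,\dots$ the company chooses a price $p_t\in\mathcal P$, and the demand $d_t=D_t(p_t)$ and the claims $c_t=C_t(p_t)$ are generated, where $(D_t(\cdot),C_t(\cdot))$ are i.i.d. random functions with the above law under $\beta_0$. Demand is observed at once; the claims $c_t$ are observed at time $t+\tau_t$, where the delays $\tau_t\in\mathbb Z_{\ge0}$ are i.i.d., $\tau_t\le m$ almost surely, and the sequence $(\tau_t)$ is independent of the random functions $(D_t,C_t)_t$. The price $p_t$ is a measurable function of the information available before period $t$: the prices and demands of the periods $i<t$ and, of the claims of these periods, those that have been observed by time $t-1$, together with their times of arrival. Write $\mathbf p(t)=(1,p_t)^\top$ and $\mathbf p(\beta)=(1,p(\beta))^\top$, and let $\lambda_{\min}(t)$ be the smallest eigenvalue of $P_t=\sum_{i=1}^t\mathbf p(i)\mathbf p(i)^\top$. The maximum quasi-likelihood estimator $\widehat\beta_t=(\widehat{\mathbf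 a}_t,\widehat{\mathbf b}_t)$ is a solution, whenever there is one, of $$\sum_{i=1}^t\frac1{\sigma_1^2}\bigl(d_i-h_1(\mathbf p(i)^\top\widehat{\mathbf a}_t)\bigr)\mathbf p(i)=0,\qquad \sum_{i\ge1:\ i+\tau_i\le t}\frac1{\sigma_2^2}\bigl(\log c_i-h_2(\mathbf p(i)^\top\widehat{\mathbf b}_t)\bigr)\mathbf p(i)=0,$$ and it is arbitrary otherwise. The regret is $\mathrm{Regret}(T)=\mathbb E\bigl[\sum_{t=1}^T\bigl(r(p^*,\beta_0)-r(p_t,\beta_0)\bigr)\bigr]$. **Theorem.** Suppose that $\widehat\beta_t$ is strongly consistent ($\widehat\beta_t\to\beta_0$ almost surely) and that there are $t_0\in\mathbb N$ and constants $c>0$, $K>0$ such that, with $L_1(t)=c\sqrt{t\log t}$, almost surely 1. $\lambda_{\min}(t)\ge L_1(t)$ for all $t\ge t_0$, and 2. $\sum_{t=1}^T\|\mathbf p(t)-\mathbf p(\widehat\beta_t)\|^2\le(2m+K)\,L_1(T)$ for all $T\ge t_0$. Then the revenue losses in the definition of the regret are integrable, and, as $T\to\infty$, $$\mathrm{Regret}(T)=O\Bigl(L_1(T)+\sum_{t=2}^T\frac{\log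 t}{L_1(t)}\Bigr).$$ -/

import Mathlib

open MeasureTheory ProbabilityTheory Filter Topology
open scoped Matrix

/-- A pair of regression parameters `β = (a, b)`, with `a = (a₀, a₁)` for the demand and
`b = (b₀, b₁)` for the logarithm of the total claims. -/
abbrev Param : Type := (Fin 2 → ℝ) × (Fin 2 → ℝ)

/-- The price vector `(1, p)ᵀ`. -/
def priceVec (p : ℝ) : Fin 2 → ℝ := ![1, p]

/-- The generalized linear pricing model with canonical links. The random demand function and the
random claims function under the parameters `a`, `b` are `D e a ·` and `C e b ·`, where the
randomness `e` has law `ν`. -/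
structure GLMPricingModel (E : Type*) [MeasurableSpace E] where
  /-- the lowest and the highest acceptable price -/
  pl : ℝ
  ph : ℝ
  pl_pos : 0 < pl
  pl_lt_ph : pl < ph
  /-- the law of the randomness of one period -/
  ν : Measure E
  isProb : IsProbabilityMeasure ν
  /-- link functions -/
  h₁ : ℝ → ℝ
  h₂ : ℝ → ℝ
  /-- variance functions -/
  v₁ : ℝ → ℝ
  v₂ : ℝ → ℝ
  /-- dispersion constants -/
  σ₁ : ℝ
  σ₂ : ℝ
  σ₁_pos : 0 < σ₁
  σ₂_pos : 0 < σ₂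
  h₁_smooth : ContDiff ℝ 2 h₁
  h₂_smooth : ContDiff ℝ 2 h₂
  v₁_smooth : ContDiff ℝ 2 v₁
  v₂_smooth : ContDiff ℝ 2 v₂
  v₁_pos : ∀ x, 0 < v₁ (h₁ x)
  v₂_pos : ∀ x, 0 < v₂ (h₂ x)
  /-- the links are canonical -/
  canonical₁ : ∀ x, deriv h₁ x = v₁ (h₁ x)
  canonical₂ : ∀ x, deriv h₂ x = v₂ (h₂ x)
  /-- demand -/
  D : E → (Fin 2 → ℝ) → ℝ → ℝ
  /-- total claims -/
  C : E → (Fin 2 → ℝ) → ℝ → ℝ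
  D_meas : ∀ a, Measurable fun q : E × ℝ => D q.1 a q.2
  C_meas : ∀ b, Measurable fun q : E × ℝ => C q.1 b q.2
  C_pos : ∀ b, ∀ p ∈ Set.Icc pl ph, ∀ᵐ e ∂ν, 0 < C e b p
  /-- for a given price, demand and claims are independent -/
  indep : ∀ a b, ∀ p ∈ Set.Icc pl ph, IndepFun (fun e => D e a p) (fun e => C e b p) ν
  D_memLp : ∀ a, ∀ p ∈ Set.Icc pl ph, MemLp (fun e => D e a p) 2 ν
  D_mean : ∀ a, ∀ p ∈ Set.Icc pl ph, ∫ e, D e a p ∂ν = h₁ (a 0 + a 1 * p)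
  D_var : ∀ a, ∀ p ∈ Set.Icc pl ph,
    variance (fun e => D e a p) ν = σ₁ ^ 2 * v₁ (∫ e, D e a p ∂ν)
  C_integrable : ∀ b, ∀ p ∈ Set.Icc pl ph, Integrable (fun e => C e b p) ν
  logC_memLp : ∀ b, ∀ p ∈ Set.Icc pl ph, MemLp (fun e => Real.log (C e b p)) 2 ν
  logC_mean : ∀ b, ∀ p ∈ Set.Icc pl ph,
    ∫ e, Real.log (C e b p) ∂ν = h₂ (b 0 + b 1 * p)
  logC_var : ∀ b, ∀ p ∈ Set.Icc pl ph,
    variance (fun e => Real.log (C e b p)) ν = σ₂ ^ 2 * v₂ (∫ e, Real.log (C e b p) ∂ν)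

namespace GLMPricingModel

variable {E : Type*} [MeasurableSpace E] (M : GLMPricingModel E)

/-- The set of acceptable prices. -/
def prices : Set ℝ := Set.Icc M.pl M.ph

/-- The expected revenue `r(p, β)` of one period. -/
noncomputable def revenue (p : ℝ) (β : Param) : ℝ :=
  ∫ e, (p * M.D e β.1 p - M.C e β.2 p) ∂M.ν

/-- `q` is an optimal price under the parameter `β`. -/
def IsOptimalPrice (β : Param) (q : ℝ) : Prop :=
  q ∈ M.prices ∧ IsMaxOn (fun p => M.revenue p β) M.prices q

/-- `pOpt` is a version of `β ↦ p(β) = argmax_p r(p, β)`: an acceptable price that maximizes the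
expected revenue under `β` whenever some acceptable price does. -/
def IsOptimalPriceMap (pOpt : Param → ℝ) : Prop :=
  ∀ β, pOpt β ∈ M.prices ∧ ((∃ q, M.IsOptimalPrice β q) → M.IsOptimalPrice β (pOpt β))

end GLMPricingModel

section DelayedModel

variable {E : Type*} [MeasurableSpace E] {Ω : Type*}

/-- The observed demand `d_t = D_t(p_t)` when the true parameter is `β₀` and the randomness of
period `t` is `ξ t`. -/
def demandAt (M : GLMPricingModel E) (β₀ : Param) (ξ : ℕ → Ω → E) (p : ℕ → Ω → ℝ)
    (t : ℕ) (ω : Ω) : ℝ :=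
  M.D (ξ t ω) β₀.1 (p t ω)

/-- The total claims `c_t = C_t(p_t)` generated by the price of period `t`. -/
def claimAt (M : GLMPricingModel E) (β₀ : Param) (ξ : ℕ → Ω → E) (p : ℕ → Ω → ℝ)
    (t : ℕ) (ω : Ω) : ℝ :=
  M.C (ξ t ω) β₀.2 (p t ω)

/-- The information available before the price of period `t` is chosen: for every period
`1 ≤ i < t` its price and demand, and, for every time `i ≤ s < t`, whether the claims of period `i`
had arrived by time `s` (that is, `i + τ i ≤ s`) together with their value if they had. -/
@[reducible] def historyAt (M : GLMPricingModel E) (β₀ : Param) (ξ : ℕ → Ω → E) (τ : ℕ → Ω → ℕ)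
    (p : ℕ → Ω → ℝ) (t : ℕ) : MeasurableSpace Ω :=
  ⨆ i ∈ Set.Ico 1 t,
    (MeasurableSpace.comap (p i) inferInstance ⊔
      MeasurableSpace.comap (demandAt M β₀ ξ p i) inferInstance ⊔
      ⨆ s ∈ Set.Ico i t,
        (MeasurableSpace.comap (fun ω => decide (i + τ i ω ≤ s)) inferInstance ⊔
          MeasurableSpace.comap
            (fun ω => if i + τ i ω ≤ s then claimAt M β₀ ξ p i ω else 0) inferInstance))

/-- The delayed pricing process: i.i.d. random demand and claims functions (one draw `ξ t` per
period), i.i.d. delays `τ t ≤ m` of the claims that are independent of the demand and claims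
functions, and acceptable prices `p t`, `t ≥ 1`, chosen from the available information.
Periods are numbered from `1`; the entries with index `0` play no role. -/
structure IsDelayedPricing [MeasurableSpace Ω] (μ : Measure Ω) (M : GLMPricingModel E)
    (β₀ : Param) (m : ℕ) (ξ : ℕ → Ω → E) (τ : ℕ → Ω → ℕ) (p : ℕ → Ω → ℝ) : Prop where
  ξ_meas : ∀ t, Measurable (ξ t)
  ξ_law : ∀ t, μ.map (ξ t) = M.ν
  ξ_indep : iIndepFun ξ μ
  τ_meas : ∀ t, Measurable (τ t)
  τ_ident : ∀ s t, IdentDistrib (τ s) (τ t) μ μ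
  τ_indep : iIndepFun τ μ
  τ_le : ∀ t, ∀ᵐ ω ∂μ, τ t ω ≤ m
  τ_indep_ξ : IndepFun (fun ω t => τ t ω) (fun ω t => ξ t ω) μ
  price_mem : ∀ t, 1 ≤ t → ∀ ω, p t ω ∈ M.prices
  price_meas : ∀ t, 1 ≤ t → Measurable[historyAt M β₀ ξ τ p t] (p t)

/-- The design matrix `P_t = ∑_{i=1}^t p(i) p(i)ᵀ`. -/
def designMatrix (p : ℕ → Ω → ℝ) (t : ℕ) (ω : Ω) : Matrix (Fin 2) (Fin 2) ℝ :=
  ∑ i ∈ Finset.Icc 1 t, Matrix.vecMulVec (priceVec (p i ω)) (priceVec (p i ω))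

theorem designMatrix_isHermitian (p : ℕ → Ω → ℝ) (t : ℕ) (ω : Ω) :
    (designMatrix p t ω).IsHermitian := by
  ext j k
  simp [designMatrix, Matrix.sum_apply, Matrix.vecMulVec_apply, mul_comm]

/-- The smallest eigenvalue of the design matrix. -/
noncomputable def lambdaMin (p : ℕ → Ω → ℝ) (t : ℕ) (ω : Ω) : ℝ :=
  ⨅ j, (designMatrix_isHermitian p t ω).eigenvalues j

/-- The periods `i ≤ t` whose claims have been observed by the end of period `t`. -/
def observedClaims (τ : ℕ → Ω → ℕ) (t : ℕ) (ω : Ω) : Finset ℕ :=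
  (Finset.Icc 1 t).filter fun i => i + τ i ω ≤ t

/-- The quasi-score of the demand parameters after `t` periods, for the canonical link. -/
noncomputable def demandScore (M : GLMPricingModel E) (β₀ : Param) (ξ : ℕ → Ω → E)
    (p : ℕ → Ω → ℝ) (t : ℕ) (ω : Ω) (a : Fin 2 → ℝ) : Fin 2 → ℝ :=
  ∑ i ∈ Finset.Icc 1 t,
    (1 / M.σ₁ ^ 2 * (demandAt M β₀ ξ p i ω - M.h₁ (priceVec (p i ω) ⬝ᵥ a))) • priceVec (p i ω)

/-- The quasi-score of the claims parameters after `t` periods, for the canonical link: it uses the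
logarithms of those claims that have been observed by then. -/
noncomputable def claimScore (M : GLMPricingModel E) (β₀ : Param) (ξ : ℕ → Ω → E)
    (τ : ℕ → Ω → ℕ) (p : ℕ → Ω → ℝ) (t : ℕ) (ω : Ω) (b : Fin 2 → ℝ) : Fin 2 → ℝ :=
  ∑ i ∈ observedClaims τ t ω,
    (1 / M.σ₂ ^ 2 * (Real.log (claimAt M β₀ ξ p i ω) - M.h₂ (priceVec (p i ω) ⬝ᵥ b))) •
      priceVec (p i ω)

/-- `β` is a maximum quasi-likelihood estimate after `t` periods, with delayed claims. -/
def IsMQLE (M : GLMPricingModel E) (β₀ : Param) (ξ : ℕ → Ω → E) (τ : ℕ → Ω → ℕ)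
    (p : ℕ → Ω → ℝ) (t : ℕ) (ω : Ω) (β : Param) : Prop :=
  demandScore M β₀ ξ p t ω β.1 = 0 ∧ claimScore M β₀ ξ τ p t ω β.2 = 0

/-- `L₁(t) = c √(t log t)`. -/
noncomputable def L₁ (c : ℝ) (t : ℕ) : ℝ := c * √(t * Real.log t)

/-- The random revenue loss `∑_{t=1}^T (r(p*) - r(p_t))` over `T` periods. -/
noncomputable def revenueLoss (M : GLMPricingModel E) (β₀ : Param) (pStar : ℝ)
    (p : ℕ → Ω → ℝ) (T : ℕ) (ω : Ω) : ℝ :=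
  ∑ t ∈ Finset.Icc 1 T, (M.revenue pStar β₀ - M.revenue (p t ω) β₀)

/-- The cumulative regret over `T` periods. -/
noncomputable def regret [MeasurableSpace Ω] (μ : Measure Ω) (M : GLMPricingModel E) (β₀ : Param)
    (pStar : ℝ) (p : ℕ → Ω → ℝ) (T : ℕ) : ℝ :=
  ∫ ω, revenueLoss M β₀ pStar p T ω ∂μ

end DelayedModel

/-! A unique nondegenerate critical maximizer makes the revenue loss comparable with `(p_t - p*)²`
on the whole price interval (`exists_sq_bounds_of_unique_max`). This square splits into the distance
of `p_t` from the certainty equivalent price, whose sum is bounded pathwise by hypothesis, and the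
distance of the certainty equivalent price from `p*`, which must be shown to have expected square
`O(log t / L₁ t)`.

The maximizer is Lipschitz in the parameter at `β₀` (`exists_lipschitz_maximizer`), so the second
distance is an estimation error. With a canonical link the quasi-score is minus the gradient of a
convex potential; if its noise part is small compared with `λ_min`, it has a zero, and every zero is
within squared distance of order noise / `λ_min` of the truth (`exists_quasiScore_eq_zero`). If the
noise is not small, the width of the price interval already gives a bound of the same form. Hence
`exists_price_error_le` is one pathwise inequality without an exceptional event.

The noise is the score of the residuals, measured in the norm of `(1 + P_t)⁻¹`. In expectation each
period adds at most the variance bound times the expected leverage of its price vector, because the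
cross term is centered given the past. The leverages are dominated by the increments of `log det (1
+ P_t)`, which is `O(log t)` (`PredictableNoise.integrable_ridgeNoise_and_le`). The added identity
keeps the design invertible from the start and is absorbed once `λ_min ≥ 1`.

Delays hide claims of the last `m` periods only. The missing information is bounded, hence
eventually at most half of the total, and the missing noise costs at most `m` squared residuals. All
delays may be treated as known from the start, since they are independent of the demand and claims
functions. -/

/-! ### Inverse quadratic forms of 2×2 matrices and rank one updates. -/

section RidgeNorm

/-- The squared norm of `(u, v)` with respect to the inverse of the matrix `!![α, β; β, γ]`. -/
noncomputable def invQuadForm (α β γ u v : ℝ) : ℝ :=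
  (γ * u ^ 2 - 2 * β * u * v + α * v ^ 2) / (α * γ - β ^ 2)

theorem invQuadForm_nonneg {α β γ : ℝ} (hα : 0 < α) (hΔ : 0 < α * γ - β ^ 2) (u v : ℝ) :
    0 ≤ invQuadForm α β γ u v := by
  refine div_nonneg ?_ hΔ.le
  have : 0 ≤ α * (γ * u ^ 2 - 2 * β * u * v + α * v ^ 2) := by
    nlinarith [sq_nonneg (α * v - β * u), mul_nonneg hΔ.le (sq_nonneg u)]
  exact nonneg_of_mul_nonneg_right this hα

/-- Cauchy–Schwarz for a norm and its dual; after clearing the determinant, the gap is a perfect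
square. -/
theorem dot_sq_le_invQuadForm_mul {α β γ : ℝ} (hΔ : 0 < α * γ - β ^ 2) (u v x y : ℝ) :
    (u * x + v * y) ^ 2 ≤
      invQuadForm α β γ u v * (α * x ^ 2 + 2 * β * x * y + γ * y ^ 2) := by
  rw [invQuadForm, div_mul_eq_mul_div, le_div_iff₀ hΔ]
  nlinarith [sq_nonneg (α * x * v + β * y * v - β * x * u - γ * y * u)]

/-- The determinant after a rank one update by `(1, p)`. -/
theorem det_rankOne {α β γ : ℝ} (p : ℝ) (hα : 0 < α) (hΔ : 0 < α * γ - β ^ 2) :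
    α * γ - β ^ 2 ≤ (α + 1) * (γ + p ^ 2) - (β + p) ^ 2 := by
  have : 0 ≤ α * (γ - 2 * β * p + α * p ^ 2) := by
    nlinarith [sq_nonneg (α * p - β)]
  have := nonneg_of_mul_nonneg_right this hα
  nlinarith

/-- A larger matrix has a smaller inverse. As in the Sherman–Morrison formula, the difference is a
square over the product of the determinants. -/
theorem invQuadForm_rankOne_le {α β γ : ℝ} (p : ℝ) (hα : 0 < α) (hΔ : 0 < α * γ - β ^ 2)
    (u v : ℝ) :
    invQuadForm (α + 1) (β + p) (γ + p ^ 2) u v ≤ invQuadForm α β γ u v := by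
  have hΔ' := hΔ.trans_le (det_rankOne p hα hΔ)
  rw [invQuadForm, invQuadForm, div_le_div_iff₀ hΔ' hΔ]
  nlinarith [sq_nonneg ((γ - β * p) * u + (α * p - β) * v)]

/-- The inner product of `(1, p)` and `(u, v)` with respect to the inverse matrix. -/
noncomputable def invBilin (α β γ p u v : ℝ) : ℝ :=
  ((γ - β * p) * u + (α * p - β) * v) / (α * γ - β ^ 2)

/-- The coefficient of `e ^ 2` is the squared norm of `(1, p)` for the updated inverse, rewritten by
the matrix determinant lemma so that it can be telescoped later. -/
theorem invQuadForm_add {α β γ : ℝ} (p e u v : ℝ) (hα : 0 < α) (hΔ : 0 < α * γ - β ^ 2) :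
    invQuadForm (α + 1) (β + p) (γ + p ^ 2) (u + e) (v + e * p) =
      invQuadForm (α + 1) (β + p) (γ + p ^ 2) u v +
        2 * (invBilin (α + 1) (β + p) (γ + p ^ 2) p u v * e) +
        (1 - (α * γ - β ^ 2) / ((α + 1) * (γ + p ^ 2) - (β + p) ^ 2)) * e ^ 2 := by
  have hΔ' := (hΔ.trans_le (det_rankOne p hα hΔ)).ne'
  rw [invQuadForm, invQuadForm, invBilin, one_sub_div hΔ']
  simp only [div_mul_eq_mul_div, mul_div_assoc', ← add_div]
  congr 1
  ring

end RidgeNorm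

/-! ### Existence, uniqueness and accuracy of zeros of the quasi-score. -/

section Estimator

variable {ι : Type*} [Fintype ι]

theorem dotProduct_self_nonneg_real (v : ι → ℝ) : 0 ≤ v ⬝ᵥ v := by
  simp only [dotProduct]
  exact Finset.sum_nonneg fun i _ => mul_self_nonneg _

/-- With `H` a primitive of the link, the summed function is a potential whose gradient is minus the
quasi-score; zeros of the score are thereby found by minimization. -/
theorem hasDerivAt_sum_primitive {h H : ℝ → ℝ} (hH : ∀ s, HasDerivAt H (h s) s) (I : Finset ℕ)
    (x : ℕ → ι → ℝ) (y : ℕ → ℝ) (a d : ι → ℝ) :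
    HasDerivAt (fun s : ℝ => ∑ i ∈ I, (H (x i ⬝ᵥ (a + s • d)) - y i * (x i ⬝ᵥ (a + s • d))))
      (∑ i ∈ I, (h (x i ⬝ᵥ a) - y i) * (x i ⬝ᵥ d)) 0 := by
  refine HasDerivAt.fun_sum fun i _ => ?_
  have h1 : HasDerivAt (fun s : ℝ => x i ⬝ᵥ (a + s • d)) (x i ⬝ᵥ d) 0 := by
    simp only [dotProduct_add, dotProduct_smul, smul_eq_mul]
    simpa using ((hasDerivAt_id (0 : ℝ)).mul_const (x i ⬝ᵥ d)).const_add (x i ⬝ᵥ a)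
  have h2 : HasDerivAt H (h (x i ⬝ᵥ a)) (x i ⬝ᵥ (a + (0 : ℝ) • d)) := by simpa using hH _
  convert! (h2.comp (0 : ℝ) h1).sub (h1.const_mul (y i)) using 1
  ring

theorem HasDerivAt.nonneg_of_le_right {f : ℝ → ℝ} {f' : ℝ} (hf : HasDerivAt f f' 0)
    (hmin : ∀ s ∈ Set.Ioc (0 : ℝ) 1, f 0 ≤ f s) : 0 ≤ f' := by
  have h := hf.tendsto_slope_zero_right
  refine ge_of_tendsto h ?_
  filter_upwards [Ioc_mem_nhdsGT (zero_lt_one' ℝ)] with s hs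
  have := hmin s hs
  simp only [zero_add, smul_eq_mul]
  exact mul_nonneg (inv_nonneg.2 hs.1.le) (by linarith)

/-- The quasi-score `∑ (yᵢ - h (xᵢ ⬝ a)) xᵢ`. -/
noncomputable def quasiScore (h : ℝ → ℝ) (I : Finset ℕ) (x : ℕ → ι → ℝ) (y : ℕ → ℝ)
    (a : ι → ℝ) : ι → ℝ :=
  ∑ i ∈ I, (y i - h (x i ⬝ᵥ a)) • x i

theorem quasiScore_dotProduct (h : ℝ → ℝ) (I : Finset ℕ) (x : ℕ → ι → ℝ) (y : ℕ → ℝ)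
    (a w : ι → ℝ) :
    quasiScore h I x y a ⬝ᵥ w = ∑ i ∈ I, (y i - h (x i ⬝ᵥ a)) * (x i ⬝ᵥ w) := by
  simp [quasiScore, sum_dotProduct]

theorem isCompact_dotProduct_ball (a₀ : ι → ℝ) (r : ℝ) :
    IsCompact {a : ι → ℝ | (a - a₀) ⬝ᵥ (a - a₀) ≤ r} := by
  refine Metric.isCompact_of_isClosed_isBounded ?_ ?_
  · refine isClosed_le ?_ continuous_const
    simp only [dotProduct]
    fun_prop
  · refine (Metric.isBounded_closedBall (x := a₀) (r := √r)).subset fun a ha => ?_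
    rw [mem_closedBall_iff_norm, pi_norm_le_iff_of_nonneg (Real.sqrt_nonneg _)]
    intro i
    refine Real.abs_le_sqrt (le_trans ?_ ha)
    simp only [dotProduct, ← pow_two]
    exact Finset.single_le_sum (f := fun i => (a - a₀) i ^ 2) (fun i _ => sq_nonneg _)
      (Finset.mem_univ i)

/-- Two zeros of the quasi-score agree when the link is strictly increasing and the design is
nondegenerate. -/
theorem quasiScore_zero_unique {h : ℝ → ℝ} (hmono : StrictMono h) {I : Finset ℕ}
    {x : ℕ → ι → ℝ} {y : ℕ → ℝ} {L : ℝ} (hL : 0 < L)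
    (hx : ∀ v, L * (v ⬝ᵥ v) ≤ ∑ i ∈ I, (x i ⬝ᵥ v) ^ 2) {a a' : ι → ℝ}
    (ha : quasiScore h I x y a = 0) (ha' : quasiScore h I x y a' = 0) : a = a' := by
  have h1 := quasiScore_dotProduct h I x y a (a - a')
  have h2 := quasiScore_dotProduct h I x y a' (a - a')
  rw [ha, zero_dotProduct] at h1
  rw [ha', zero_dotProduct] at h2
  have h3 : ∑ i ∈ I, (h (x i ⬝ᵥ a) - h (x i ⬝ᵥ a')) * (x i ⬝ᵥ a - x i ⬝ᵥ a') = 0 := by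
    have : (0 : ℝ) = 0 - 0 := by ring
    rw [this]; nth_rw 1 [h2]; rw [h1, ← Finset.sum_sub_distrib]
    exact Finset.sum_congr rfl fun i _ => by rw [dotProduct_sub]; ring
  rw [Finset.sum_eq_zero_iff_of_nonneg] at h3
  · have h4 : ∑ i ∈ I, (x i ⬝ᵥ (a - a')) ^ 2 = 0 := by
      refine Finset.sum_eq_zero fun i hi => ?_
      rw [dotProduct_sub]
      rcases mul_eq_zero.1 (h3 i hi) with h5 | h5
      · rw [hmono.injective (sub_eq_zero.1 h5)]; ring
      · rw [h5]; ring
    have h5 := hx (a - a')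
    rw [h4] at h5
    have h6 := dotProduct_self_nonneg_real (a - a')
    have h7 : (a - a') ⬝ᵥ (a - a') = 0 := by nlinarith
    exact sub_eq_zero.1 (dotProduct_self_eq_zero.1 h7)
  · intro i _
    rcases le_total (x i ⬝ᵥ a) (x i ⬝ᵥ a') with h5 | h5
    · exact mul_nonneg_of_nonpos_of_nonpos (sub_nonpos.2 (hmono.monotone h5)) (sub_nonpos.2 h5)
    · exact mul_nonneg (sub_nonneg.2 (hmono.monotone h5)) (sub_nonneg.2 h5)

/-- If the noise part of the quasi-score is small compared with the design, then the quasi-score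
has a zero, and every zero is close to the true parameter. -/
theorem exists_quasiScore_eq_zero {h : ℝ → ℝ} (hd : Differentiable ℝ h) (hmono : StrictMono h)
    {lo up κ : ℝ} (hκ : 0 < κ) (hh : ∀ s ∈ Set.Icc lo up, κ ≤ deriv h s)
    {I : Finset ℕ} {x : ℕ → ι → ℝ} {y : ℕ → ℝ} {a₀ : ι → ℝ} {ρ L B : ℝ} (hL : 0 < L) (hB0 : 0 ≤ B)
    (hρ : 0 ≤ ρ) (hrange : ∀ i ∈ I, ∀ a, (a - a₀) ⬝ᵥ (a - a₀) ≤ ρ → x i ⬝ᵥ a ∈ Set.Icc lo up)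
    (hx : ∀ v, L * (v ⬝ᵥ v) ≤ ∑ i ∈ I, (x i ⬝ᵥ v) ^ 2)
    (hB : ∀ v, (∑ i ∈ I, (y i - h (x i ⬝ᵥ a₀)) * (x i ⬝ᵥ v)) ^ 2 ≤
      B * ∑ i ∈ I, (x i ⬝ᵥ v) ^ 2)
    (hBL : B < κ ^ 2 * L * ρ) :
    (∃ a, quasiScore h I x y a = 0) ∧
      ∀ a, quasiScore h I x y a = 0 → κ ^ 2 * L * ((a - a₀) ⬝ᵥ (a - a₀)) ≤ B := by
  set K := {a : ι → ℝ | (a - a₀) ⬝ᵥ (a - a₀) ≤ ρ} with hK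
  have ha₀K : a₀ ∈ K := by simpa [hK] using hρ
  obtain ⟨H, hH⟩ : ∃ H : ℝ → ℝ, ∀ s, HasDerivAt H (h s) s :=
    ⟨fun s => ∫ r in (0 : ℝ)..s, h r, fun s =>
      intervalIntegral.integral_hasDerivAt_right (hd.continuous.intervalIntegrable _ _)
        hd.continuous.stronglyMeasurable.stronglyMeasurableAtFilter hd.continuous.continuousAt⟩
  have hHc : Continuous H := continuous_iff_continuousAt.2 fun s => (hH s).continuousAt
  -- a point of `K` where the score does not point away from `a₀` is close to `a₀`
  have close : ∀ a ∈ K, 0 ≤ quasiScore h I x y a ⬝ᵥ (a - a₀) →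
      κ ^ 2 * L * ((a - a₀) ⬝ᵥ (a - a₀)) ≤ B := by
    intro a ha hs
    set v := a - a₀ with hv
    set S := ∑ i ∈ I, (x i ⬝ᵥ v) ^ 2 with hS
    have hS0 : 0 ≤ S := Finset.sum_nonneg fun i _ => sq_nonneg _
    have h1 : κ * S ≤ ∑ i ∈ I, (y i - h (x i ⬝ᵥ a₀)) * (x i ⬝ᵥ v) := by
      rw [quasiScore_dotProduct] at hs
      have h2 : κ * S ≤ ∑ i ∈ I, (h (x i ⬝ᵥ a) - h (x i ⬝ᵥ a₀)) * (x i ⬝ᵥ v) := by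
        rw [hS, Finset.mul_sum]
        refine Finset.sum_le_sum fun i hi => ?_
        have r1 := hrange i hi a ha
        have r2 := hrange i hi a₀ ha₀K
        rw [hv, dotProduct_sub]
        have mono := (convex_Icc lo up).mul_sub_le_image_sub_of_le_deriv
          hd.continuous.continuousOn hd.differentiableOn
          (fun s hs => hh s (interior_subset hs))
        rcases le_total (x i ⬝ᵥ a) (x i ⬝ᵥ a₀) with h5 | h5
        · have := mono _ r1 _ r2 h5
          nlinarith
        · have := mono _ r2 _ r1 h5
          nlinarith
      have h3 : ∑ i ∈ I, (h (x i ⬝ᵥ a) - h (x i ⬝ᵥ a₀)) * (x i ⬝ᵥ v) +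
          ∑ i ∈ I, (y i - h (x i ⬝ᵥ a)) * (x i ⬝ᵥ v) =
          ∑ i ∈ I, (y i - h (x i ⬝ᵥ a₀)) * (x i ⬝ᵥ v) := by
        rw [← Finset.sum_add_distrib]
        exact Finset.sum_congr rfl fun i _ => by ring
      linarith
    have h2 : (κ * S) ^ 2 ≤ B * S :=
      (pow_le_pow_left₀ (mul_nonneg hκ.le hS0) h1 2).trans (hB v)
    have h3 : L * (v ⬝ᵥ v) ≤ S := hx v
    -- The inequality `(κ S)² ≤ B S` is divided by `S`, so `S = 0` is treated apart; it forces `a =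
    -- a₀`.
    rcases hS0.eq_or_lt with h0 | h0
    · have hvv := dotProduct_self_nonneg_real v
      have : v ⬝ᵥ v = 0 := by rw [← h0] at h3; nlinarith
      rw [this, mul_zero]
      exact hB0
    · have h4 : κ ^ 2 * S ≤ B := by
        have : κ ^ 2 * S * S ≤ B * S := by nlinarith
        exact le_of_mul_le_mul_right this h0
      calc κ ^ 2 * L * (v ⬝ᵥ v) = κ ^ 2 * (L * (v ⬝ᵥ v)) := by ring
        _ ≤ κ ^ 2 * S := by gcongr
        _ ≤ B := h4
  obtain ⟨a, haK, hmin⟩ := (isCompact_dotProduct_ball a₀ ρ).exists_isMinOn ⟨a₀, ha₀K⟩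
    (f := fun a => ∑ i ∈ I, (H (x i ⬝ᵥ a) - y i * (x i ⬝ᵥ a)))
    (by
      have : ∀ i, Continuous fun a : ι → ℝ => x i ⬝ᵥ a := fun i => by
        simp only [dotProduct]; fun_prop
      exact Continuous.continuousOn (by fun_prop))
  -- First-order condition at the constrained minimizer: the potential cannot decrease along an
  -- admissible direction.
  have hdir : ∀ d, (∀ s ∈ Set.Ioc (0 : ℝ) 1, a + s • d ∈ K) →
      quasiScore h I x y a ⬝ᵥ d ≤ 0 := by
    intro d hdK
    have h1 := (hasDerivAt_sum_primitive hH I x y a d).nonneg_of_le_right (fun s hs => by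
      simpa using hmin (hdK s hs))
    rw [quasiScore_dotProduct, ← neg_nonneg, ← Finset.sum_neg_distrib]
    exact h1.trans_eq (Finset.sum_congr rfl fun i _ => by ring)
  -- The direction towards `a₀` is always admissible, so `close` applies to the minimizer and the
  -- strict bound `hBL` places it inside the ball. There every short step is admissible, in
  -- particular one along the score itself, which must therefore vanish.
  have hinner : (a - a₀) ⬝ᵥ (a - a₀) < ρ := by
    have h1 : 0 ≤ quasiScore h I x y a ⬝ᵥ (a - a₀) := by
      have := hdir (a₀ - a) (fun s hs => by
        have h2 : a + s • (a₀ - a) - a₀ = (1 - s) • (a - a₀) := by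
          ext j; simp; ring
        have h3 : (a - a₀) ⬝ᵥ (a - a₀) ≤ ρ := haK
        simp only [hK, Set.mem_ofPred_eq]
        rw [h2, dotProduct_smul, smul_dotProduct, smul_eq_mul, smul_eq_mul]
        have h4 : (1 - s) * (1 - s) ≤ 1 := by nlinarith [hs.1, hs.2]
        nlinarith [dotProduct_self_nonneg_real (a - a₀)])
      have h2 : a₀ - a = -(a - a₀) := by abel
      rw [h2, dotProduct_neg] at this
      linarith
    have h2 := (close a haK h1).trans_lt hBL
    exact lt_of_mul_lt_mul_left h2 (by positivity)
  have hzero : quasiScore h I x y a = 0 := by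
    set w := quasiScore h I x y a with hw
    have hcont : Continuous fun s : ℝ => (a + s • w - a₀) ⬝ᵥ (a + s • w - a₀) := by
      simp only [dotProduct, Pi.add_apply, Pi.sub_apply, Pi.smul_apply]; fun_prop
    have hev : ∀ᶠ s : ℝ in 𝓝 0, (a + s • w - a₀) ⬝ᵥ (a + s • w - a₀) < ρ :=
      (hcont.tendsto 0).eventually (gt_mem_nhds (by simpa using hinner))
    obtain ⟨ε, hε, hball⟩ := Metric.eventually_nhds_iff.1 hev
    have h1 := hdir ((ε / 2) • w) (fun s hs => by
      rw [smul_smul]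
      refine (hball ?_).le
      rw [Real.dist_eq, sub_zero, abs_of_pos (by have := hs.1; positivity)]
      nlinarith [hs.1, hs.2])
    rw [dotProduct_smul, smul_eq_mul] at h1
    exact dotProduct_self_eq_zero.1 (le_antisymm (by nlinarith) (dotProduct_self_nonneg_real w))
  refine ⟨⟨a, hzero⟩, fun a' ha' => ?_⟩
  -- Uniqueness is global, so the bound also covers zeros not known in advance to lie in the ball.
  rw [quasiScore_zero_unique hmono hL hx ha' hzero]
  exact close a haK (by rw [hzero, zero_dotProduct])

end Estimator

/-! ### The smallest eigenvalue as a lower bound for the design form. -/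

section LambdaMin

variable {Ω : Type*}

/-- `B = A - ℓ` has nonnegative trace and determinant. By Cayley–Hamilton, `tr B` times the form of
`B` at `v` equals `|B v|² + det B |v|²`, so the form is nonnegative when the trace is positive;
trace zero forces `B = 0`. -/
theorem Matrix.IsHermitian.le_quadForm_two {A : Matrix (Fin 2) (Fin 2) ℝ} (hA : A.IsHermitian)
    {ℓ : ℝ} (hℓ : ∀ j, ℓ ≤ hA.eigenvalues j) (v : Fin 2 → ℝ) :
    ℓ * (v ⬝ᵥ v) ≤ A 0 0 * v 0 ^ 2 + 2 * A 0 1 * v 0 * v 1 + A 1 1 * v 1 ^ 2 := by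
  have htr := hA.trace_eq_sum_eigenvalues
  have hdet := hA.det_eq_prod_eigenvalues
  have hsymm : A 1 0 = A 0 1 := by simpa using hA.apply 0 1
  simp only [Matrix.trace_fin_two, Fin.sum_univ_two, RCLike.ofReal_real_eq_id, id] at htr
  simp only [Matrix.det_fin_two, Fin.prod_univ_two, RCLike.ofReal_real_eq_id, id, hsymm] at hdet
  have h0 := hℓ 0
  have h1 := hℓ 1
  have hD : 0 ≤ (A 0 0 - ℓ) * (A 1 1 - ℓ) - A 0 1 ^ 2 := by
    have : (A 0 0 - ℓ) * (A 1 1 - ℓ) - A 0 1 ^ 2 =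
        (hA.eigenvalues 0 - ℓ) * (hA.eigenvalues 1 - ℓ) := by
      linear_combination hdet - ℓ * htr
    rw [this]
    exact mul_nonneg (sub_nonneg.2 h0) (sub_nonneg.2 h1)
  have hs : 0 ≤ (A 0 0 - ℓ) + (A 1 1 - ℓ) := by linarith
  simp only [dotProduct, Fin.sum_univ_two]
  generalize A 0 0 = α at *
  generalize A 0 1 = β at *
  generalize A 1 1 = γ at *
  generalize v 0 = x at *
  generalize v 1 = y at *
  have key : 0 ≤ (α - ℓ) * x ^ 2 + 2 * β * x * y + (γ - ℓ) * y ^ 2 := by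
    rcases hs.eq_or_lt with h | h
    · have h2 : α - ℓ = 0 ∧ β = 0 := by
        have h3 : γ - ℓ = -(α - ℓ) := by linarith
        rw [h3] at hD
        constructor <;> nlinarith [sq_nonneg (α - ℓ), sq_nonneg β]
      have h3 : γ - ℓ = 0 := by linarith [h2.1]
      rw [h2.1, h2.2, h3]; simp
    · have : 0 ≤ ((α - ℓ) + (γ - ℓ)) *
          ((α - ℓ) * x ^ 2 + 2 * β * x * y + (γ - ℓ) * y ^ 2) := by
        nlinarith [sq_nonneg ((α - ℓ) * x + β * y), sq_nonneg (β * x + (γ - ℓ) * y),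
          mul_nonneg hD (add_nonneg (sq_nonneg x) (sq_nonneg y))]
      exact nonneg_of_mul_nonneg_right this h
  nlinarith

theorem priceVec_dotProduct (p : ℝ) (v : Fin 2 → ℝ) : priceVec p ⬝ᵥ v = v 0 + p * v 1 := by
  simp [priceVec, dotProduct, Fin.sum_univ_two]

theorem le_sum_sq_of_le_lambdaMin {p : ℕ → Ω → ℝ} {t : ℕ} {ω : Ω} {ℓ : ℝ}
    (hℓ : ℓ ≤ lambdaMin p t ω) (v : Fin 2 → ℝ) :
    ℓ * (v ⬝ᵥ v) ≤ ∑ i ∈ Finset.Icc 1 t, (priceVec (p i ω) ⬝ᵥ v) ^ 2 := by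
  have h := (designMatrix_isHermitian p t ω).le_quadForm_two (ℓ := ℓ)
    (fun j => hℓ.trans (ciInf_le (Set.finite_range _).bddBelow j)) v
  refine h.trans_eq ?_
  simp only [designMatrix, Matrix.sum_apply, Matrix.vecMulVec_apply, Finset.sum_mul,
    Finset.mul_sum, ← Finset.sum_add_distrib, priceVec_dotProduct]
  refine Finset.sum_congr rfl fun i _ => ?_
  simp [priceVec]
  ring

end LambdaMin

/-! ### Quadratic loss and Lipschitz dependence of the optimal price. -/

section Revenue

/-- Around a unique nondegenerate critical maximizer the loss is comparable with the square of the
distance, on the whole interval. -/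
theorem exists_sq_bounds_of_unique_max {f : ℝ → ℝ} {a b q : ℝ} (hq : q ∈ Set.Icc a b)
    (hf : ContDiffOn ℝ 2 f (Set.Icc a b)) (hmax : ∀ x ∈ Set.Icc a b, x ≠ q → f x < f q)
    (h1 : derivWithin f (Set.Icc a b) q = 0)
    (h2 : iteratedDerivWithin 2 f (Set.Icc a b) q < 0) :
    ∃ k > 0, ∃ C > 0, ∀ x ∈ Set.Icc a b,
      k * (x - q) ^ 2 ≤ f q - f x ∧ f q - f x ≤ C * (x - q) ^ 2 := by
  set s := iteratedDerivWithin 2 f (Set.Icc a b) q with hs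
  have hT := taylor_isLittleO (n := 2) (convex_Icc a b) hq (by exact_mod_cast hf)
  -- A remainder of at most half the quadratic term leaves the loss between `-s/4` and `-3s/4` times
  -- the squared distance.
  have h4 := hT.def (c := -s / 4) (by linarith)
  have hev : ∃ ε > 0, ∀ x ∈ Set.Icc a b, |x - q| < ε →
      |f x - (f q + s / 2 * (x - q) ^ 2)| ≤ -s / 4 * (x - q) ^ 2 := by
    rw [eventually_nhdsWithin_iff, Metric.eventually_nhds_iff] at h4
    obtain ⟨ε, hε, h⟩ := h4
    refine ⟨ε, hε, fun x hx hxq => ?_⟩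
    have := h (by rwa [Real.dist_eq]) hx
    rw [show taylorWithinEval f 2 (Set.Icc a b) q x = f q + s / 2 * (x - q) ^ 2 by
      rw [taylorWithinEval_succ, taylorWithinEval_succ, taylor_within_zero_eval,
        iteratedDerivWithin_one, h1, ← hs]
      simp
      ring] at this
    simpa using this
  obtain ⟨ε, hε, hnear⟩ := hev
  have hcomp : IsCompact (Set.Icc a b ∩ {x | ε ≤ |x - q|}) :=
    isCompact_Icc.inter_right (isClosed_le continuous_const (by fun_prop))
  have hfc : ContinuousOn (fun x => f q - f x) (Set.Icc a b ∩ {x | ε ≤ |x - q|}) :=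
    (continuousOn_const.sub hf.continuousOn).mono Set.inter_subset_left
  have hfar : ∃ k > 0, ∃ C > 0, ∀ x ∈ Set.Icc a b, ε ≤ |x - q| →
      k ≤ f q - f x ∧ f q - f x ≤ C := by
    rcases (Set.Icc a b ∩ {x | ε ≤ |x - q|}).eq_empty_or_nonempty with he | hne
    · exact ⟨1, one_pos, 1, one_pos, fun x hx hx' =>
        absurd (show x ∈ Set.Icc a b ∩ {x | ε ≤ |x - q|} from ⟨hx, hx'⟩) (by simp [he])⟩
    · obtain ⟨y, hy, hymin⟩ := hcomp.exists_isMinOn hne hfc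
      obtain ⟨z, hz, hzmax⟩ := hcomp.exists_isMaxOn hne hfc
      have pos : ∀ y ∈ Set.Icc a b ∩ {x | ε ≤ |x - q|}, 0 < f q - f y := fun y hy =>
        sub_pos.2 (hmax y hy.1 (by
          rintro rfl
          have h5 : ε ≤ |y - y| := hy.2
          simp at h5; linarith))
      exact ⟨_, pos y hy, _, pos z hz, fun x hx hx' => ⟨hymin ⟨hx, hx'⟩, hzmax ⟨hx, hx'⟩⟩⟩
  obtain ⟨k, hk, C, hC, hfar⟩ := hfar
  -- The added `1` keeps the denominator positive even for a one-point interval.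
  have hab : 0 < b - a + 1 := by linarith [hq.1, hq.2]
  refine ⟨min (-s / 4) (k / (b - a + 1) ^ 2), by
      have : 0 < -s / 4 := by linarith
      positivity, max (-s) (C / ε ^ 2), by
      have : 0 < -s := by linarith
      positivity, fun x hx => ?_⟩
  have hsq : 0 ≤ (x - q) ^ 2 := sq_nonneg _
  rcases lt_or_ge |x - q| ε with h | h
  · have h5 := abs_le.1 (hnear x hx h)
    constructor
    · refine (mul_le_mul_of_nonneg_right (min_le_left _ _) hsq).trans ?_
      nlinarith [h5.2]
    · refine le_trans ?_ (mul_le_mul_of_nonneg_right (le_max_left _ _) hsq)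
      nlinarith [h5.1]
  · obtain ⟨h5, h6⟩ := hfar x hx h
    have h7 : ε ^ 2 ≤ (x - q) ^ 2 := by
      rw [← sq_abs (x - q)]; exact pow_le_pow_left₀ hε.le h 2
    have h8 : (x - q) ^ 2 ≤ (b - a + 1) ^ 2 := by
      refine sq_le_sq' ?_ ?_ <;> linarith [hx.1, hx.2, hq.1, hq.2]
    constructor
    · refine (mul_le_mul_of_nonneg_right (min_le_right _ _) hsq).trans ?_
      refine le_trans ?_ h5
      rw [div_mul_eq_mul_div, div_le_iff₀ (by positivity)]
      gcongr
    · refine h6.trans (le_trans ?_ (mul_le_mul_of_nonneg_right (le_max_right _ _) hsq))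
      rw [div_mul_eq_mul_div, le_div_iff₀ (by positivity)]
      gcongr

/-- If `F` is twice continuously differentiable, `F · β₀` grows quadratically away from its
maximizer `q`, then maximizers of `F · β` depend on `β` in a Lipschitz way at `β₀`. -/
theorem exists_lipschitz_maximizer {X : Type*} [NormedAddCommGroup X] [NormedSpace ℝ X]
    [ProperSpace X] {F : ℝ × X → ℝ} {a b q k : ℝ} (hab : a < b) {V : Set X} (hV : IsOpen V)
    {β₀ : X} (hβ₀ : β₀ ∈ V) (hF : ContDiffOn ℝ 2 F (Set.Icc a b ×ˢ V)) (hk : 0 < k)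
    (hq : q ∈ Set.Icc a b)
    (hquad : ∀ x ∈ Set.Icc a b, k * (x - q) ^ 2 ≤ F (q, β₀) - F (x, β₀)) :
    ∃ ρ > 0, ∃ C > 0, Metric.closedBall β₀ ρ ⊆ V ∧ ∀ β ∈ Metric.closedBall β₀ ρ,
      ∀ x ∈ Set.Icc a b, F (q, β) ≤ F (x, β) → |x - q| ≤ C * ‖β - β₀‖ := by
  obtain ⟨ρ, hρ, hball⟩ := Metric.nhds_basis_closedBall.mem_iff.1 (hV.mem_nhds hβ₀)
  set S := Set.Icc a b ×ˢ V with hS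
  set K := Set.Icc a b ×ˢ Metric.closedBall β₀ ρ with hK
  have hKS : K ⊆ S := Set.prod_mono_right hball
  have hud : UniqueDiffOn ℝ S := (uniqueDiffOn_Icc hab).prod hV.uniqueDiffOn
  have hG : ContDiffOn ℝ 1 (fderivWithin ℝ F S) S := hF.fderivWithin hud (by norm_num)
  set G := fderivWithin ℝ F S with hGdef
  have hG' : ContinuousOn (fderivWithin ℝ G S) S := hG.continuousOn_fderivWithin hud le_rfl
  have hKc : IsCompact K := isCompact_Icc.prod (isCompact_closedBall β₀ ρ)
  obtain ⟨N, hN⟩ := hKc.exists_bound_of_continuousOn (f := fderivWithin ℝ G S) (hG'.mono hKS)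
  have hKconv : Convex ℝ K := (convex_Icc a b).prod (convex_closedBall β₀ ρ)
  have hLip : ∀ y ∈ K, ∀ z ∈ K, ‖G z - G y‖ ≤ N * ‖z - y‖ := fun y hy z hz =>
    hKconv.norm_image_sub_le_of_norm_hasFDerivWithin_le
      (fun w hw => ((hG.differentiableOn one_ne_zero w (hKS hw)).hasFDerivWithinAt).mono hKS)
      hN hy hz
  have hN0 : 0 ≤ N := (norm_nonneg _).trans
    (hN (q, β₀) ⟨hq, Metric.mem_closedBall_self hρ.le⟩)
  have hpartial : ∀ β ∈ V, ∀ x ∈ Set.Icc a b,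
      HasDerivWithinAt (fun x => F (x, β)) (G (x, β) (1, 0)) (Set.Icc a b) x := by
    intro β hβ x hx
    have h1 : HasFDerivWithinAt F (G (x, β)) S (x, β) :=
      (hF.differentiableOn two_ne_zero _ ⟨hx, hβ⟩).hasFDerivWithinAt
    have h2 : HasDerivWithinAt (fun x : ℝ => (x, β)) ((1 : ℝ), (0 : X)) (Set.Icc a b) x :=
      (hasDerivWithinAt_id x _).prodMk (hasDerivWithinAt_const x _ β)
    exact h1.comp_hasDerivWithinAt x h2 fun y hy => Set.mk_mem_prod hy hβ
  -- `N + 1` instead of `N`, since `N` may vanish and the constant must be positive.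
  refine ⟨ρ, hρ, (N + 1) / k, by positivity, hball, fun β hβ x hx hle => ?_⟩
  -- The difference of the two revenue curves has slope at most `N ‖β - β₀‖`. Comparing it at `x`
  -- and `q` bounds the quadratic growth by `N ‖β - β₀‖ |x - q|`, and one factor `|x - q|` cancels.
  have hbound := (convex_Icc a b).norm_image_sub_le_of_norm_hasDerivWithin_le
    (f := fun y => F (y, β₀) - F (y, β)) (f' := fun y => G (y, β₀) (1, 0) - G (y, β) (1, 0))
    (C := N * ‖β - β₀‖) (fun y hy => (hpartial β₀ hβ₀ y hy).sub (hpartial β (hball hβ) y hy))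
    (fun y hy => by
      have h1 := hLip (y, β) ⟨hy, hβ⟩ (y, β₀) ⟨hy, Metric.mem_closedBall_self hρ.le⟩
      have h2 : ‖((y, β₀) : ℝ × X) - (y, β)‖ = ‖β - β₀‖ := by
        simp [Prod.norm_def, norm_sub_rev β₀ β]
      rw [h2] at h1
      rw [← sub_apply]
      refine ((G (y, β₀) - G (y, β)).le_opNorm _).trans ?_
      simpa [Prod.norm_def] using h1) hx hq
  have h3 := hquad x hx
  have h4 := le_of_abs_le hbound
  rw [Real.norm_eq_abs, abs_sub_comm q x] at h4
  have h5 : k * |x - q| ^ 2 ≤ N * ‖β - β₀‖ * |x - q| := by rw [sq_abs]; linarith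
  rw [div_mul_eq_mul_div, le_div_iff₀ hk]
  rcases (abs_nonneg (x - q)).eq_or_lt with h | h
  · rw [← h, zero_mul]; positivity
  · have h6 : k * |x - q| ≤ N * ‖β - β₀‖ := le_of_mul_le_mul_right (by linarith) h
    nlinarith [norm_nonneg (β - β₀)]

end Revenue

/-! ### Moments of noise weighted by the past. -/

section Independence

variable {Ω : Type*} {𝒢 : MeasurableSpace Ω} {mΩ : MeasurableSpace Ω} {μ : Measure Ω} [IsProbabilityMeasure μ]

/-- The triple has the product law of its three marginals, so the brackets can be moved. -/
theorem IndepFun.prodMk_of_prodMk {α β γ : Type*} [MeasurableSpace α] [MeasurableSpace β]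
    [MeasurableSpace γ] {T : Ω → α} {X : Ω → β} {Y : Ω → γ} (hT : Measurable T)
    (hX : Measurable X) (hY : Measurable Y) (h : IndepFun T (fun ω => (X ω, Y ω)) μ)
    (hXY : IndepFun X Y μ) : IndepFun (fun ω => (T ω, X ω)) Y μ := by
  have : IsProbabilityMeasure (μ.map T) := Measure.isProbabilityMeasure_map hT.aemeasurable
  have : IsProbabilityMeasure (μ.map X) := Measure.isProbabilityMeasure_map hX.aemeasurable
  have : IsProbabilityMeasure (μ.map Y) := Measure.isProbabilityMeasure_map hY.aemeasurable
  have hTX : IndepFun T X μ := h.comp measurable_id measurable_fst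
  rw [indepFun_iff_map_prod_eq_prod_map_map (hT.prodMk hX).aemeasurable hY.aemeasurable]
  rw [indepFun_iff_map_prod_eq_prod_map_map hT.aemeasurable (hX.prodMk hY).aemeasurable,
    (indepFun_iff_map_prod_eq_prod_map_map hX.aemeasurable hY.aemeasurable).1 hXY] at h
  rw [(indepFun_iff_map_prod_eq_prod_map_map hT.aemeasurable hX.aemeasurable).1 hTX]
  have h1 := congrArg (Measure.map MeasurableEquiv.prodAssoc.symm) h
  rw [Measure.map_map (MeasurableEquiv.measurable _) (hT.prodMk (hX.prodMk hY))] at h1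
  have h2 : (μ.map T).prod ((μ.map X).prod (μ.map Y)) =
      Measure.map MeasurableEquiv.prodAssoc (((μ.map T).prod (μ.map X)).prod (μ.map Y)) :=
    Measure.prodAssoc_prod.symm
  rw [h2, Measure.map_map (MeasurableEquiv.measurable _) (MeasurableEquiv.measurable _)] at h1
  simpa [Function.comp_def, MeasurableEquiv.prodAssoc] using h1

variable {E : Type*} [MeasurableSpace E] {ν : Measure E}
  {X : Ω → E} {Y q : Ω → ℝ} {φ : E × ℝ → ℝ} {S : Set ℝ}

/-- Replaces conditioning by Fubini: weight and price are frozen while the fresh randomness is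
integrated against `ν`. -/
theorem map_prod_of_indep (hX : Measurable X) (hlaw : μ.map X = ν) (h𝒢 : 𝒢 ≤ mΩ)
    (hind : Indep 𝒢 (MeasurableSpace.comap X inferInstance) μ) (hY : Measurable[𝒢] Y)
    (hq : Measurable[𝒢] q) :
    μ.map (fun ω => ((Y ω, q ω), X ω)) = (μ.map fun ω => (Y ω, q ω)).prod ν := by
  have hW : Measurable[𝒢] fun ω => (Y ω, q ω) := hY.prodMk hq
  have h1 : IndepFun (fun ω => (Y ω, q ω)) X μ := indep_of_indep_of_le_left hind hW.comap_le
  rw [(indepFun_iff_map_prod_eq_prod_map_map (hW.mono h𝒢 le_rfl).aemeasurable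
    hX.aemeasurable).1 h1, hlaw]

variable [IsProbabilityMeasure ν]

/-- A centered noise is orthogonal to the past. -/
theorem integral_mul_noise_eq_zero (hX : Measurable X) (hlaw : μ.map X = ν) (h𝒢 : 𝒢 ≤ mΩ)
    (hind : Indep 𝒢 (MeasurableSpace.comap X inferInstance) μ) (hY : Measurable[𝒢] Y)
    (hq : Measurable[𝒢] q) (hφ : Measurable φ) (hS : MeasurableSet S) (hqS : ∀ ω, q ω ∈ S)
    (hmean : ∀ r ∈ S, ∫ e, φ (e, r) ∂ν = 0)
    (hint : Integrable (fun ω => Y ω * φ (X ω, q ω)) μ) :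
    ∫ ω, Y ω * φ (X ω, q ω) ∂μ = 0 := by
  have hW : Measurable fun ω => (Y ω, q ω) := (hY.prodMk hq).mono h𝒢 le_rfl
  have hWX : Measurable fun ω => ((Y ω, q ω), X ω) := hW.prodMk hX
  set F : (ℝ × ℝ) × E → ℝ := fun z => z.1.1 * φ (z.2, z.1.2) with hF
  have hFm : Measurable F := by fun_prop
  have hmap := map_prod_of_indep hX hlaw h𝒢 hind hY hq
  have h1 : ∫ ω, Y ω * φ (X ω, q ω) ∂μ = ∫ z, F z ∂(μ.map fun ω => ((Y ω, q ω), X ω)) :=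
    (integral_map hWX.aemeasurable hFm.aestronglyMeasurable).symm
  have : IsProbabilityMeasure (μ.map fun ω => (Y ω, q ω)) :=
    Measure.isProbabilityMeasure_map hW.aemeasurable
  have h2 : Integrable F (μ.map fun ω => ((Y ω, q ω), X ω)) :=
    (integrable_map_measure hFm.aestronglyMeasurable hWX.aemeasurable).2 hint
  rw [h1]
  rw [hmap] at h2 ⊢
  rw [integral_prod _ h2]
  refine integral_eq_zero_of_ae ?_
  have h3 : ∀ᵐ w ∂(μ.map fun ω => (Y ω, q ω)), w.2 ∈ S :=
    (ae_map_iff hW.aemeasurable (measurable_snd hS)).2 (ae_of_all _ hqS)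
  filter_upwards [h3] with w hw
  simp [hF, integral_const_mul, hmean _ hw]

/-- The weighted second moment of a noise, with a weight that depends on the past. -/
theorem integral_mul_noise_sq_le (hX : Measurable X) (hlaw : μ.map X = ν) (h𝒢 : 𝒢 ≤ mΩ)
    (hind : Indep 𝒢 (MeasurableSpace.comap X inferInstance) μ) (hY : Measurable[𝒢] Y)
    (hq : Measurable[𝒢] q) (hφ : Measurable φ) (hS : MeasurableSet S) (hqS : ∀ ω, q ω ∈ S)
    {s : ℝ} (hsq : ∀ r ∈ S, Integrable (fun e => φ (e, r) ^ 2) ν)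
    (hle : ∀ r ∈ S, ∫ e, φ (e, r) ^ 2 ∂ν ≤ s) (hY0 : ∀ ω, 0 ≤ Y ω) (hY1 : ∀ ω, Y ω ≤ 1) :
    Integrable (fun ω => Y ω * φ (X ω, q ω) ^ 2) μ ∧
      ∫ ω, Y ω * φ (X ω, q ω) ^ 2 ∂μ ≤ s * ∫ ω, Y ω ∂μ := by
  have hYm : Measurable Y := hY.mono h𝒢 le_rfl
  have hW : Measurable fun ω => (Y ω, q ω) := (hY.prodMk hq).mono h𝒢 le_rfl
  have hWX : Measurable fun ω => ((Y ω, q ω), X ω) := hW.prodMk hX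
  set F : (ℝ × ℝ) × E → ℝ := fun z => z.1.1 * φ (z.2, z.1.2) ^ 2 with hF
  have hFm : Measurable F := by fun_prop
  have hmap := map_prod_of_indep hX hlaw h𝒢 hind hY hq
  set κ := μ.map fun ω => (Y ω, q ω) with hκ
  have : IsProbabilityMeasure κ := Measure.isProbabilityMeasure_map hW.aemeasurable
  have h3 : ∀ᵐ w ∂κ, w.2 ∈ S ∧ 0 ≤ w.1 ∧ w.1 ≤ 1 :=
    (ae_map_iff hW.aemeasurable ((measurable_snd hS).inter
      ((measurableSet_le measurable_const measurable_fst).inter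
        (measurableSet_le measurable_fst measurable_const)))).2
      (ae_of_all _ fun ω => ⟨hqS ω, hY0 ω, hY1 ω⟩)
  have hs0 : ∀ r ∈ S, 0 ≤ s := fun r hr => (integral_nonneg fun e => sq_nonneg _).trans (hle r hr)
  have hslice : ∀ᵐ w ∂κ, 0 ≤ ∫ e, F (w, e) ∂ν ∧ ∫ e, F (w, e) ∂ν ≤ s * w.1 := by
    filter_upwards [h3] with w hw
    simp only [hF, integral_const_mul]
    refine ⟨mul_nonneg hw.2.1 (integral_nonneg fun e => sq_nonneg _), ?_⟩
    rw [mul_comm s]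
    exact mul_le_mul_of_nonneg_left (hle _ hw.1) hw.2.1
  have hF0 : ∀ᵐ w ∂κ, ∀ e, 0 ≤ F (w, e) := by
    filter_upwards [h3] with w hw e using mul_nonneg hw.2.1 (sq_nonneg _)
  have hint : Integrable F (κ.prod ν) := by
    rw [integrable_prod_iff hFm.aestronglyMeasurable]
    refine ⟨?_, ?_⟩
    · filter_upwards [h3] with w hw using (hsq _ hw.1).const_mul w.1
    · refine Integrable.of_bound (C := s) ?_ ?_
      · exact (StronglyMeasurable.integral_prod_right (f := fun w e => ‖F (w, e)‖)
          hFm.norm.stronglyMeasurable).aestronglyMeasurable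
      · filter_upwards [h3, hslice, hF0] with w hw hw2 hw3
        have h4 : ∫ e, ‖F (w, e)‖ ∂ν = ∫ e, F (w, e) ∂ν :=
          integral_congr_ae (ae_of_all _ fun e => Real.norm_of_nonneg (hw3 e))
        rw [h4, Real.norm_of_nonneg hw2.1]
        refine hw2.2.trans ?_
        nlinarith [hs0 _ hw.1, hw.2.2]
  have hYint : Integrable Y μ :=
    Integrable.of_bound (C := 1) hYm.aestronglyMeasurable
      (ae_of_all _ fun ω => by rw [Real.norm_of_nonneg (hY0 ω)]; exact hY1 ω)
  constructor
  · exact (integrable_map_measure hFm.aestronglyMeasurable hWX.aemeasurable).1 (hmap ▸ hint)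
  · have h1 : ∫ ω, Y ω * φ (X ω, q ω) ^ 2 ∂μ = ∫ z, F z ∂(μ.map fun ω => ((Y ω, q ω), X ω)) :=
      (integral_map hWX.aemeasurable hFm.aestronglyMeasurable).symm
    have h5 : Integrable (fun w : ℝ × ℝ => w.1) κ :=
      (integrable_map_measure measurable_fst.aestronglyMeasurable hW.aemeasurable).2 hYint
    have h6 : ∫ w, w.1 ∂κ = ∫ ω, Y ω ∂μ :=
      integral_map hW.aemeasurable measurable_fst.aestronglyMeasurable
    rw [h1, hmap, integral_prod _ hint, ← h6, ← integral_const_mul]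
    exact integral_mono_ae hint.integral_prod_left (h5.const_mul s)
      (hslice.mono fun w hw => hw.2)

end Independence

/-! ### The self-normalized noise and its one-step recursion. -/

section Ridge

/-- The determinant of `1 + ∑ p(i) p(i)ᵀ`. -/
noncomputable def ridgeDet (p : ℕ → ℝ) (t : ℕ) : ℝ :=
  (1 + t) * (1 + ∑ i ∈ Finset.Icc 1 t, p i ^ 2) - (∑ i ∈ Finset.Icc 1 t, p i) ^ 2

/-- The squared norm of `(u, v)` with respect to the inverse of `1 + ∑ p(i) p(i)ᵀ`. -/
noncomputable def ridgeForm (p : ℕ → ℝ) (t : ℕ) (u v : ℝ) : ℝ :=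
  invQuadForm (1 + t) (∑ i ∈ Finset.Icc 1 t, p i) (1 + ∑ i ∈ Finset.Icc 1 t, p i ^ 2) u v

/-- The self-normalized noise `∑ xᵢ p(i)` of a ridge regression on the price vectors. -/
noncomputable def ridgeNoise (p x : ℕ → ℝ) (t : ℕ) : ℝ :=
  ridgeForm p t (∑ i ∈ Finset.Icc 1 t, x i) (∑ i ∈ Finset.Icc 1 t, x i * p i)

theorem ridgeDet_zero (p : ℕ → ℝ) : ridgeDet p 0 = 1 := by simp [ridgeDet]

theorem ridgeDet_succ (p : ℕ → ℝ) (t : ℕ) :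
    ridgeDet p (t + 1) = (1 + t + 1) * (1 + ∑ i ∈ Finset.Icc 1 t, p i ^ 2 + p (t + 1) ^ 2) -
      (∑ i ∈ Finset.Icc 1 t, p i + p (t + 1)) ^ 2 := by
  rw [ridgeDet, Finset.sum_Icc_succ_top (by lia), Finset.sum_Icc_succ_top (by lia)]
  push_cast
  ring

theorem one_le_ridgeDet (p : ℕ → ℝ) (t : ℕ) : 1 ≤ ridgeDet p t := by
  induction t with
  | zero => rw [ridgeDet_zero]
  | succ t ih =>
    rw [ridgeDet_succ]
    exact ih.trans (det_rankOne _ (by positivity) (one_pos.trans_le ih))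

theorem ridgeDet_pos (p : ℕ → ℝ) (t : ℕ) : 0 < ridgeDet p t :=
  one_pos.trans_le (one_le_ridgeDet p t)

theorem ridgeDet_le_succ (p : ℕ → ℝ) (t : ℕ) : ridgeDet p t ≤ ridgeDet p (t + 1) := by
  rw [ridgeDet_succ]
  exact det_rankOne _ (by positivity) (ridgeDet_pos p t)

theorem ridgeDet_le {p : ℕ → ℝ} {t : ℕ} {r : ℝ} (hp : ∀ i, 1 ≤ i → p i ^ 2 ≤ r) :
    ridgeDet p t ≤ (1 + t) * (1 + t * r) := by
  have : ∑ i ∈ Finset.Icc 1 t, p i ^ 2 ≤ t * r := by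
    refine (Finset.sum_le_card_nsmul _ _ r fun i hi => hp i (Finset.mem_Icc.1 hi).1).trans ?_
    simp
  calc ridgeDet p t ≤ (1 + t) * (1 + ∑ i ∈ Finset.Icc 1 t, p i ^ 2) :=
        sub_le_self _ (sq_nonneg _)
    _ ≤ _ := by gcongr

theorem ridgeForm_nonneg (p : ℕ → ℝ) (t : ℕ) (u v : ℝ) : 0 ≤ ridgeForm p t u v :=
  invQuadForm_nonneg (by positivity) (ridgeDet_pos p t) u v

theorem ridgeForm_succ (p : ℕ → ℝ) (t : ℕ) (u v : ℝ) :
    ridgeForm p (t + 1) u v = invQuadForm (1 + t + 1) (∑ i ∈ Finset.Icc 1 t, p i + p (t + 1))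
      (1 + ∑ i ∈ Finset.Icc 1 t, p i ^ 2 + p (t + 1) ^ 2) u v := by
  rw [ridgeForm, Finset.sum_Icc_succ_top (by lia), Finset.sum_Icc_succ_top (by lia)]
  push_cast
  congr 1 <;> ring

theorem ridgeForm_succ_le (p : ℕ → ℝ) (t : ℕ) (u v : ℝ) :
    ridgeForm p (t + 1) u v ≤ ridgeForm p t u v := by
  rw [ridgeForm_succ]
  exact invQuadForm_rankOne_le _ (by positivity) (ridgeDet_pos p t) u v

/-- The inner product of the last price vector and the past noise. -/
noncomputable def ridgeCross (p x : ℕ → ℝ) (t : ℕ) : ℝ :=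
  invBilin (1 + t + 1) (∑ i ∈ Finset.Icc 1 t, p i + p (t + 1))
    (1 + ∑ i ∈ Finset.Icc 1 t, p i ^ 2 + p (t + 1) ^ 2) (p (t + 1))
    (∑ i ∈ Finset.Icc 1 t, x i) (∑ i ∈ Finset.Icc 1 t, x i * p i)

/-- The past noise, normalized with the current design. -/
noncomputable def ridgePast (p x : ℕ → ℝ) (t : ℕ) : ℝ :=
  ridgeForm p (t + 1) (∑ i ∈ Finset.Icc 1 t, x i) (∑ i ∈ Finset.Icc 1 t, x i * p i)

/-- The squared norm of the last price vector with respect to the inverse of the design. -/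
noncomputable def ridgeLeverage (p : ℕ → ℝ) (t : ℕ) : ℝ :=
  1 - ridgeDet p t / ridgeDet p (t + 1)

/-- The past noise is normalized with the design that already contains the new price. That price is
known before the new residual, so every coefficient is predictable. -/
theorem ridgeNoise_succ (p x : ℕ → ℝ) (t : ℕ) :
    ridgeNoise p x (t + 1) = ridgePast p x t + 2 * (ridgeCross p x t * x (t + 1)) +
      ridgeLeverage p t * x (t + 1) ^ 2 := by
  rw [ridgeNoise, ridgePast, ridgeForm_succ, ridgeForm_succ, ridgeCross, ridgeLeverage,
    Finset.sum_Icc_succ_top (by lia), Finset.sum_Icc_succ_top (by lia),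
    invQuadForm_add _ _ _ _ (by positivity) (ridgeDet_pos p t), ridgeDet_succ]
  rfl

/-- The recursion is a nonnegative quadratic in the new residual; evaluating it at both signs
isolates the cross term. This provides an integrable majorant for it. -/
theorem abs_ridgeCross_le (p x : ℕ → ℝ) (t : ℕ) :
    |2 * (ridgeCross p x t * x (t + 1))| ≤
      ridgePast p x t + ridgeLeverage p t * x (t + 1) ^ 2 := by
  have key : ∀ e : ℝ, 0 ≤ ridgePast p x t + 2 * (ridgeCross p x t * e) +
      ridgeLeverage p t * e ^ 2 := fun e => by
    rw [ridgePast, ridgeForm_succ, ridgeCross, ridgeLeverage, ridgeDet_succ]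
    refine (invQuadForm_nonneg (u := (∑ i ∈ Finset.Icc 1 t, x i) + e)
      (v := (∑ i ∈ Finset.Icc 1 t, x i * p i) + e * p (t + 1)) (by positivity) ?_).trans_eq
      (invQuadForm_add _ _ _ _ (by positivity) (ridgeDet_pos p t))
    rw [← ridgeDet_succ]
    exact ridgeDet_pos p _
  have h1 := key (x (t + 1))
  have h2 := key (-x (t + 1))
  rw [neg_sq] at h2
  rw [abs_le]
  constructor <;> linarith

theorem ridgeLeverage_nonneg (p : ℕ → ℝ) (t : ℕ) : 0 ≤ ridgeLeverage p t :=
  sub_nonneg.2 ((div_le_one (ridgeDet_pos p _)).2 (ridgeDet_le_succ p t))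

theorem ridgeLeverage_le_one (p : ℕ → ℝ) (t : ℕ) : ridgeLeverage p t ≤ 1 :=
  sub_le_self _ (div_nonneg (ridgeDet_pos p _).le (ridgeDet_pos p _).le)

/-- `1 - 1/y ≤ log y` at the ratio of consecutive determinants, which makes the leverages telescope.
-/
theorem ridgeLeverage_le_log (p : ℕ → ℝ) (t : ℕ) :
    ridgeLeverage p t ≤ Real.log (ridgeDet p (t + 1)) - Real.log (ridgeDet p t) := by
  rw [← Real.log_div (ridgeDet_pos p _).ne' (ridgeDet_pos p _).ne', ridgeLeverage]
  have := Real.one_sub_inv_le_log_of_pos (div_pos (ridgeDet_pos p (t + 1)) (ridgeDet_pos p t))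
  rwa [inv_div] at this

/-- The noise part of the quasi-score, tested against `v`. -/
theorem sum_noise_sq_le (p x : ℕ → ℝ) (t : ℕ) (v : Fin 2 → ℝ) :
    (∑ i ∈ Finset.Icc 1 t, x i * (priceVec (p i) ⬝ᵥ v)) ^ 2 ≤
      ridgeNoise p x t * (v ⬝ᵥ v + ∑ i ∈ Finset.Icc 1 t, (priceVec (p i) ⬝ᵥ v) ^ 2) := by
  have h := dot_sq_le_invQuadForm_mul (ridgeDet_pos p t) (∑ i ∈ Finset.Icc 1 t, x i)
    (∑ i ∈ Finset.Icc 1 t, x i * p i) (v 0) (v 1)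
  have h1 : ∑ i ∈ Finset.Icc 1 t, x i * (priceVec (p i) ⬝ᵥ v) =
      (∑ i ∈ Finset.Icc 1 t, x i) * v 0 + (∑ i ∈ Finset.Icc 1 t, x i * p i) * v 1 := by
    simp only [priceVec_dotProduct, Finset.sum_mul, ← Finset.sum_add_distrib]
    exact Finset.sum_congr rfl fun i _ => by ring
  have h2 : v ⬝ᵥ v + ∑ i ∈ Finset.Icc 1 t, (priceVec (p i) ⬝ᵥ v) ^ 2 =
      (1 + t) * v 0 ^ 2 + 2 * (∑ i ∈ Finset.Icc 1 t, p i) * v 0 * v 1 +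
        (1 + ∑ i ∈ Finset.Icc 1 t, p i ^ 2) * v 1 ^ 2 := by
    have h3 : ∑ i ∈ Finset.Icc 1 t, (priceVec (p i) ⬝ᵥ v) ^ 2 =
        t * v 0 ^ 2 + 2 * (∑ i ∈ Finset.Icc 1 t, p i) * v 0 * v 1 +
        (∑ i ∈ Finset.Icc 1 t, p i ^ 2) * v 1 ^ 2 := by
      have : (t : ℝ) * v 0 ^ 2 = ∑ i ∈ Finset.Icc 1 t, v 0 ^ 2 := by simp
      rw [this]
      simp only [priceVec_dotProduct, Finset.mul_sum, Finset.sum_mul, ← Finset.sum_add_distrib]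
      exact Finset.sum_congr rfl fun i _ => by ring
    rw [h3]
    simp only [dotProduct, Fin.sum_univ_two]
    ring
  rw [h1, h2]
  exact h

variable {Ω : Type*} [MeasurableSpace Ω]

theorem measurable_ridgeDet {p : ℕ → Ω → ℝ} {t : ℕ} (hp : ∀ i, 1 ≤ i → i ≤ t → Measurable (p i)) :
    Measurable fun ω => ridgeDet (fun i => p i ω) t := by
  have h1 : Measurable fun ω => ∑ i ∈ Finset.Icc 1 t, p i ω := Finset.measurable_fun_sum _
    fun i hi => hp i (Finset.mem_Icc.1 hi).1 (Finset.mem_Icc.1 hi).2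
  have h2 : Measurable fun ω => ∑ i ∈ Finset.Icc 1 t, p i ω ^ 2 := Finset.measurable_fun_sum _
    fun i hi => (hp i (Finset.mem_Icc.1 hi).1 (Finset.mem_Icc.1 hi).2).pow_const 2
  unfold ridgeDet
  fun_prop

theorem measurable_ridgeCross {p x : ℕ → Ω → ℝ} {t : ℕ}
    (hp : ∀ i, 1 ≤ i → i ≤ t + 1 → Measurable (p i)) (hx : ∀ i, 1 ≤ i → i ≤ t → Measurable (x i)) :
    Measurable fun ω => ridgeCross (fun i => p i ω) (fun i => x i ω) t := by
  have h0 : ∀ i ∈ Finset.Icc 1 t, Measurable (p i) := fun i hi =>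
    hp i (Finset.mem_Icc.1 hi).1 ((Finset.mem_Icc.1 hi).2.trans t.le_succ)
  have h0' : ∀ i ∈ Finset.Icc 1 t, Measurable (x i) := fun i hi =>
    hx i (Finset.mem_Icc.1 hi).1 (Finset.mem_Icc.1 hi).2
  have h1 : Measurable fun ω => ∑ i ∈ Finset.Icc 1 t, p i ω := Finset.measurable_fun_sum _ h0
  have h2 : Measurable fun ω => ∑ i ∈ Finset.Icc 1 t, p i ω ^ 2 := Finset.measurable_fun_sum _
    fun i hi => (h0 i hi).pow_const 2
  have h3 : Measurable fun ω => ∑ i ∈ Finset.Icc 1 t, x i ω := Finset.measurable_fun_sum _ h0'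
  have h4 : Measurable fun ω => ∑ i ∈ Finset.Icc 1 t, x i ω * p i ω :=
    Finset.measurable_fun_sum _ fun i hi => (h0' i hi).mul (h0 i hi)
  have h5 := hp (t + 1) (by lia) le_rfl
  unfold ridgeCross invBilin
  fun_prop

theorem measurable_ridgePast {p x : ℕ → Ω → ℝ} {t : ℕ}
    (hp : ∀ i, 1 ≤ i → i ≤ t + 1 → Measurable (p i)) (hx : ∀ i, 1 ≤ i → i ≤ t → Measurable (x i)) :
    Measurable fun ω => ridgePast (fun i => p i ω) (fun i => x i ω) t := by
  have h0 : ∀ i ∈ Finset.Icc 1 t, Measurable (p i) := fun i hi =>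
    hp i (Finset.mem_Icc.1 hi).1 ((Finset.mem_Icc.1 hi).2.trans t.le_succ)
  have h0' : ∀ i ∈ Finset.Icc 1 t, Measurable (x i) := fun i hi =>
    hx i (Finset.mem_Icc.1 hi).1 (Finset.mem_Icc.1 hi).2
  have h1 : Measurable fun ω => ∑ i ∈ Finset.Icc 1 t, p i ω := Finset.measurable_fun_sum _ h0
  have h2 : Measurable fun ω => ∑ i ∈ Finset.Icc 1 t, p i ω ^ 2 := Finset.measurable_fun_sum _
    fun i hi => (h0 i hi).pow_const 2
  have h3 : Measurable fun ω => ∑ i ∈ Finset.Icc 1 t, x i ω := Finset.measurable_fun_sum _ h0'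
  have h4 : Measurable fun ω => ∑ i ∈ Finset.Icc 1 t, x i ω * p i ω :=
    Finset.measurable_fun_sum _ fun i hi => (h0' i hi).mul (h0 i hi)
  have h5 := hp (t + 1) (by lia) le_rfl
  unfold ridgePast
  simp only [ridgeForm_succ, invQuadForm]
  fun_prop

end Ridge

/-! ### Logarithmic growth of the expected self-normalized noise. -/

section Noise

/-- A noise that is centered with bounded variance for every acceptable price, and prices that are
chosen from a past `𝒢 t` that is independent of the randomness `ξ t` of period `t`. -/
structure PredictableNoise {E : Type*} [MeasurableSpace E] {Ω : Type*} [MeasurableSpace Ω]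
    (μ : Measure Ω) (ν : Measure E) (S : Set ℝ) (s : ℝ) (φ : E × ℝ → ℝ)
    (𝒢 : ℕ → MeasurableSpace Ω) (ξ : ℕ → Ω → E) (p : ℕ → Ω → ℝ) : Prop where
  meas : Measurable φ
  measS : MeasurableSet S
  integrable_sq : ∀ r ∈ S, Integrable (fun e => φ (e, r) ^ 2) ν
  mean : ∀ r ∈ S, ∫ e, φ (e, r) ∂ν = 0
  sq_le : ∀ r ∈ S, ∫ e, φ (e, r) ^ 2 ∂ν ≤ s
  mono : Monotone 𝒢
  le : ∀ t, 𝒢 t ≤ ‹MeasurableSpace Ω›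
  ξ_meas : ∀ t, Measurable[𝒢 (t + 1)] (ξ t)
  law : ∀ t, μ.map (ξ t) = ν
  indep : ∀ t, Indep (𝒢 t) (MeasurableSpace.comap (ξ t) inferInstance) μ
  price_meas : ∀ t, 1 ≤ t → Measurable[𝒢 t] (p t)
  price_mem : ∀ t, 1 ≤ t → ∀ ω, p t ω ∈ S

namespace PredictableNoise

variable {E : Type*} [MeasurableSpace E] {Ω : Type*} [mΩ : MeasurableSpace Ω]
  {μ : Measure Ω} {ν : Measure E} {S : Set ℝ}
  {s : ℝ} {φ : E × ℝ → ℝ} {𝒢 : ℕ → MeasurableSpace Ω} {ξ : ℕ → Ω → E} {p : ℕ → Ω → ℝ}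

theorem price_meas_of_le (H : PredictableNoise μ ν S s φ 𝒢 ξ p)
    {i t : ℕ} (h1 : 1 ≤ i) (hit : i ≤ t) : Measurable[𝒢 t] (p i) :=
  (H.price_meas i h1).mono (H.mono hit) le_rfl

theorem noise_meas (H : PredictableNoise μ ν S s φ 𝒢 ξ p)
    {i t : ℕ} (h1 : 1 ≤ i) (hit : i < t) :
    Measurable[𝒢 t] fun ω => φ (ξ i ω, p i ω) :=
  H.meas.comp (((H.ξ_meas i).mono (H.mono hit) le_rfl).prodMk (H.price_meas_of_le h1 hit.le))

variable [IsProbabilityMeasure μ] [IsProbabilityMeasure ν]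

theorem noise_sq (H : PredictableNoise μ ν S s φ 𝒢 ξ p) {t : ℕ} (ht : 1 ≤ t) :
    Integrable (fun ω => φ (ξ t ω, p t ω) ^ 2) μ ∧ ∫ ω, φ (ξ t ω, p t ω) ^ 2 ∂μ ≤ s := by
  have h := integral_mul_noise_sq_le (Y := fun _ => 1) ((H.ξ_meas t).mono (H.le _) le_rfl)
    (H.law t) (H.le t) (H.indep t) measurable_const (H.price_meas t ht) H.meas H.measS
    (H.price_mem t ht) H.integrable_sq H.sq_le (fun _ => zero_le_one) (fun _ => le_rfl)
  simpa using h

theorem var_nonneg (H : PredictableNoise μ ν S s φ 𝒢 ξ p) : 0 ≤ s := by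
  have h := H.noise_sq le_rfl
  exact (integral_nonneg fun ω => sq_nonneg _).trans h.2

/-- Induction along `ridgeNoise_succ`: the past term does not grow, the cross term has mean zero,
and the last term costs at most `s` times an increment of the expected log-determinant.
Integrability is carried along because it justifies the mean-zero claim. -/
theorem integrable_ridgeNoise_and_le (H : PredictableNoise μ ν S s φ 𝒢 ξ p) {r : ℝ}
    (hr : ∀ q ∈ S, q ^ 2 ≤ r) (t : ℕ) :
    Integrable (fun ω => ridgeNoise (fun i => p i ω) (fun i => φ (ξ i ω, p i ω)) t) μ ∧
      ∫ ω, ridgeNoise (fun i => p i ω) (fun i => φ (ξ i ω, p i ω)) t ∂μ ≤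
        s * ∫ ω, Real.log (ridgeDet (fun i => p i ω) t) ∂μ := by
  have hlog : ∀ t, Integrable (fun ω => Real.log (ridgeDet (fun i => p i ω) t)) μ := fun t => by
    refine Integrable.of_bound (C := Real.log ((1 + t) * (1 + t * r))) ?_ (ae_of_all _ fun ω => ?_)
    · exact (Real.measurable_log.comp (measurable_ridgeDet fun i h1 _ =>
        (H.price_meas i h1).mono (H.le i) le_rfl)).aestronglyMeasurable
    · rw [Real.norm_of_nonneg (Real.log_nonneg (one_le_ridgeDet _ _))]
      exact Real.log_le_log (ridgeDet_pos _ _)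
        (ridgeDet_le fun i hi => hr _ (H.price_mem i hi ω))
  induction t with
  | zero => simp [ridgeNoise, ridgeForm, invQuadForm, ridgeDet_zero]
  | succ t ih =>
    have hle := H.le (t + 1)
    have hξ : Measurable (ξ (t + 1)) := (H.ξ_meas (t + 1)).mono (H.le _) le_rfl
    have hcross : Measurable[𝒢 (t + 1)] fun ω =>
        ridgeCross (fun i => p i ω) (fun i => φ (ξ i ω, p i ω)) t :=
      @measurable_ridgeCross _ (𝒢 (t + 1)) _ _ _ (fun i h1 h2 => H.price_meas_of_le h1 h2)
        (fun i h1 h2 => H.noise_meas h1 (Nat.lt_succ_of_le h2))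
    have hpast : Measurable[𝒢 (t + 1)] fun ω =>
        ridgePast (fun i => p i ω) (fun i => φ (ξ i ω, p i ω)) t :=
      @measurable_ridgePast _ (𝒢 (t + 1)) _ _ _ (fun i h1 h2 => H.price_meas_of_le h1 h2)
        (fun i h1 h2 => H.noise_meas h1 (Nat.lt_succ_of_le h2))
    have hlev : Measurable[𝒢 (t + 1)] fun ω => ridgeLeverage (fun i => p i ω) t :=
      measurable_const.sub (Measurable.div
        (@measurable_ridgeDet _ (𝒢 (t + 1)) _ _ fun i h1 h2 =>
          H.price_meas_of_le h1 (h2.trans t.le_succ))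
        (@measurable_ridgeDet _ (𝒢 (t + 1)) _ _ fun i h1 h2 => H.price_meas_of_le h1 h2))
    obtain ⟨hsq, hsqle⟩ := integral_mul_noise_sq_le hξ (H.law _) hle (H.indep _) hlev
      (H.price_meas (t + 1) (by lia)) H.meas H.measS (H.price_mem (t + 1) (by lia))
      H.integrable_sq H.sq_le (fun ω => ridgeLeverage_nonneg _ t)
      (fun ω => ridgeLeverage_le_one _ t)
    have hpastint : Integrable (fun ω =>
        ridgePast (fun i => p i ω) (fun i => φ (ξ i ω, p i ω)) t) μ := by
      refine ih.1.mono' (hpast.mono hle le_rfl).aestronglyMeasurable (ae_of_all _ fun ω => ?_)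
      rw [ridgePast, Real.norm_of_nonneg (ridgeForm_nonneg _ _ _ _)]
      exact ridgeForm_succ_le _ _ _ _
    have hx : Measurable fun ω => φ (ξ (t + 1) ω, p (t + 1) ω) :=
      (H.noise_meas (by lia) (Nat.lt_succ_self _)).mono (H.le (t + 2)) le_rfl
    have hprod : Integrable (fun ω => ridgeCross (fun i => p i ω) (fun i => φ (ξ i ω, p i ω)) t *
        φ (ξ (t + 1) ω, p (t + 1) ω)) μ := by
      have h1 : Integrable (fun ω => 2 * (ridgeCross (fun i => p i ω)
          (fun i => φ (ξ i ω, p i ω)) t * φ (ξ (t + 1) ω, p (t + 1) ω))) μ :=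
        (hpastint.add hsq).mono'
          (((hcross.mono hle le_rfl).mul hx).const_mul 2).aestronglyMeasurable
          (ae_of_all _ fun ω => abs_ridgeCross_le _ _ t)
      refine (h1.const_mul (1 / 2)).congr (ae_of_all _ fun ω => ?_)
      ring
    have hzero := integral_mul_noise_eq_zero hξ (H.law _) hle (H.indep _) hcross
      (H.price_meas (t + 1) (by lia)) H.meas H.measS (H.price_mem (t + 1) (by lia)) H.mean hprod
    have hlevint : Integrable (fun ω => ridgeLeverage (fun i => p i ω) t) μ :=
      Integrable.of_bound (C := 1) (hlev.mono hle le_rfl).aestronglyMeasurable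
        (ae_of_all _ fun ω => by
          rw [Real.norm_of_nonneg (ridgeLeverage_nonneg _ t)]; exact ridgeLeverage_le_one _ t)
    simp only [ridgeNoise_succ]
    refine ⟨(hpastint.add (hprod.const_mul 2)).add hsq, ?_⟩
    have hsum := integral_add (hpastint.add (hprod.const_mul 2)) hsq
    simp only [Pi.add_apply] at hsum
    rw [hsum, integral_add hpastint (hprod.const_mul 2), integral_const_mul, hzero, mul_zero, add_zero]
    have h1 : ∫ ω, ridgePast (fun i => p i ω) (fun i => φ (ξ i ω, p i ω)) t ∂μ ≤
        ∫ ω, ridgeNoise (fun i => p i ω) (fun i => φ (ξ i ω, p i ω)) t ∂μ :=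
      integral_mono hpastint ih.1 fun ω => ridgeForm_succ_le _ _ _ _
    have h2 : ∫ ω, ridgeLeverage (fun i => p i ω) t ∂μ ≤
        ∫ ω, Real.log (ridgeDet (fun i => p i ω) (t + 1)) ∂μ -
          ∫ ω, Real.log (ridgeDet (fun i => p i ω) t) ∂μ := by
      rw [← integral_sub (hlog _) (hlog _)]
      exact integral_mono hlevint ((hlog _).sub (hlog _)) fun ω => ridgeLeverage_le_log _ t
    have h3 := mul_le_mul_of_nonneg_left h2 H.var_nonneg
    linarith [ih.2]

theorem integral_ridgeNoise_le (H : PredictableNoise μ ν S s φ 𝒢 ξ p) {r : ℝ}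
    (hr : ∀ q ∈ S, q ^ 2 ≤ r) (t : ℕ) :
    ∫ ω, ridgeNoise (fun i => p i ω) (fun i => φ (ξ i ω, p i ω)) t ∂μ ≤
        s * Real.log ((1 + t) * (1 + t * r)) := by
  refine (H.integrable_ridgeNoise_and_le hr t).2.trans
    (mul_le_mul_of_nonneg_left ?_ H.var_nonneg)
  have h1 : ∀ ω, Real.log (ridgeDet (fun i => p i ω) t) ≤ Real.log ((1 + t) * (1 + t * r)) :=
    fun ω => Real.log_le_log (ridgeDet_pos _ _)
      (ridgeDet_le fun i hi => hr _ (H.price_mem i hi ω))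
  have h0 : ∀ ω, 0 ≤ Real.log (ridgeDet (fun i => p i ω) t) := fun ω =>
    Real.log_nonneg (one_le_ridgeDet _ _)
  refine (integral_mono_of_nonneg (ae_of_all _ h0) (integrable_const _) (ae_of_all _ h1)).trans ?_
  simp

/-- The squared noise of the last `m` periods. -/
theorem recent_noise (H : PredictableNoise μ ν S s φ 𝒢 ξ p) (m t : ℕ) :
    Integrable (fun ω => ∑ i ∈ (Finset.Icc 1 t).filter fun i => t < i + m,
      φ (ξ i ω, p i ω) ^ 2) μ ∧
    ∫ ω, ∑ i ∈ (Finset.Icc 1 t).filter fun i => t < i + m, φ (ξ i ω, p i ω) ^ 2 ∂μ ≤ m * s := by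
  have h1 : ∀ i ∈ (Finset.Icc 1 t).filter fun i => t < i + m,
      Integrable (fun ω => φ (ξ i ω, p i ω) ^ 2) μ := fun i hi =>
    (H.noise_sq (Finset.mem_Icc.1 (Finset.mem_filter.1 hi).1).1).1
  refine ⟨integrable_finsetSum _ h1, ?_⟩
  rw [integral_finsetSum _ h1]
  have hcard : ((Finset.Icc 1 t).filter fun i => t < i + m).card ≤ m := by
    have : ((Finset.Icc 1 t).filter fun i => t < i + m) ⊆ Finset.Ico (t + 1 - m) (t + 1) := by
      intro i hi
      simp only [Finset.mem_filter, Finset.mem_Icc, Finset.mem_Ico] at hi ⊢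
      lia
    refine (Finset.card_le_card this).trans ?_
    simp only [Nat.card_Ico]
    lia
  refine (Finset.sum_le_card_nsmul _ _ s fun i hi =>
    (H.noise_sq (Finset.mem_Icc.1 (Finset.mem_filter.1 hi).1).1).2).trans ?_
  rw [nsmul_eq_mul]
  exact mul_le_mul_of_nonneg_right (by exact_mod_cast hcard) H.var_nonneg

end PredictableNoise

end Noise

/-! ### The filtration of the delayed pricing process. -/

section Past

variable {E : Type*} [MeasurableSpace E] {Ω : Type*}

/-- The information in all delays and in the randomness of the periods before `n`. -/
@[reducible] def pastInfo (ξ : ℕ → Ω → E) (τ : ℕ → Ω → ℕ) (n : ℕ) : MeasurableSpace Ω :=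
  MeasurableSpace.comap
    (fun ω => ((fun t => τ t ω), fun i : Finset.range n => ξ i ω)) inferInstance

variable {ξ : ℕ → Ω → E} {τ : ℕ → Ω → ℕ}

theorem measurable_delay_pastInfo (n t : ℕ) : Measurable[pastInfo ξ τ n] (τ t) :=
  Measurable.comp (g := fun z : (ℕ → ℕ) × (Finset.range n → E) => z.1 t) (by fun_prop)
    (comap_measurable _)

theorem measurable_random_pastInfo {n i : ℕ} (hi : i < n) : Measurable[pastInfo ξ τ n] (ξ i) :=
  Measurable.comp
    (g := fun z : (ℕ → ℕ) × (Finset.range n → E) => z.2 ⟨i, Finset.mem_range.2 hi⟩)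
    (by fun_prop) (comap_measurable _)

theorem pastInfo_mono : Monotone (pastInfo ξ τ) := by
  intro n k hnk
  refine Measurable.comap_le (Measurable.prodMk ?_ ?_)
  · exact @measurable_pi_lambda _ _ _ (pastInfo ξ τ k) _ _ fun t => measurable_delay_pastInfo k t
  · exact @measurable_pi_lambda _ _ _ (pastInfo ξ τ k) _ _ fun i =>
      measurable_random_pastInfo ((Finset.mem_range.1 i.2).trans_le hnk)

variable [MeasurableSpace Ω] {μ : Measure Ω}
  {M : GLMPricingModel E} {β₀ : Param} {m : ℕ} {p : ℕ → Ω → ℝ}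

namespace IsDelayedPricing

theorem pastInfo_le (H : IsDelayedPricing μ M β₀ m ξ τ p) (n : ℕ) :
    pastInfo ξ τ n ≤ ‹MeasurableSpace Ω› :=
  Measurable.comap_le ((measurable_pi_lambda _ H.τ_meas).prodMk
    (measurable_pi_lambda _ fun i => H.ξ_meas i))

/-- The whole delay sequence, future delays included, can belong to the past, because it is
independent of all the `ξ` jointly. -/
theorem indep_pastInfo [IsProbabilityMeasure μ] (H : IsDelayedPricing μ M β₀ m ξ τ p) (n : ℕ) :
    Indep (pastInfo ξ τ n) (MeasurableSpace.comap (ξ n) inferInstance) μ := by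
  have h1 : IndepFun (fun ω (i : Finset.range n) => ξ i ω) (ξ n) μ := by
    have h := H.ξ_indep.indepFun_finset (Finset.range n) {n} (by simp) H.ξ_meas
    exact h.comp (φ := id) (ψ := fun z : (({n} : Finset ℕ) → E) => z ⟨n, by simp⟩)
      measurable_id (by fun_prop)
  have h2 : IndepFun (fun ω t => τ t ω)
      (fun ω => ((fun i : Finset.range n => ξ i ω), ξ n ω)) μ :=
    H.τ_indep_ξ.comp (φ := id)
      (ψ := fun z : ℕ → E => ((fun i : Finset.range n => z i), z n)) measurable_id (by fun_prop)
  exact IndepFun.prodMk_of_prodMk (measurable_pi_lambda _ H.τ_meas)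
    (measurable_pi_lambda _ fun i => H.ξ_meas i) (H.ξ_meas n) h2 h1

/-- Strong induction: observations of period `i` depend on `p i`, which is itself measurable with
respect to the earlier history. -/
theorem historyAt_le (H : IsDelayedPricing μ M β₀ m ξ τ p) (t : ℕ) :
    historyAt M β₀ ξ τ p t ≤ pastInfo ξ τ t := by
  induction t using Nat.strong_induction_on with
  | _ t ih =>
    refine iSup₂_le fun i hi => ?_
    have hξ : Measurable[pastInfo ξ τ t] (ξ i) := measurable_random_pastInfo hi.2
    have hp : Measurable[pastInfo ξ τ t] (p i) :=
      (H.price_meas i hi.1).mono ((ih i hi.2).trans (pastInfo_mono hi.2.le)) le_rfl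
    have hclaim : Measurable[pastInfo ξ τ t] (claimAt M β₀ ξ p i) :=
      (M.C_meas β₀.2).comp (hξ.prodMk hp)
    refine sup_le (sup_le hp.comap_le ?_) (iSup₂_le fun s _ => sup_le ?_ ?_)
    · exact Measurable.comap_le ((M.D_meas β₀.1).comp (hξ.prodMk hp))
    · exact Measurable.comap_le (Measurable.comp
        (g := fun k : ℕ => decide (i + k ≤ s)) (by fun_prop) (measurable_delay_pastInfo t i))
    · refine Measurable.comap_le (Measurable.ite ?_ hclaim measurable_const)
      exact (measurable_delay_pastInfo t i) (t := {k | i + k ≤ s}) trivial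

theorem predictableNoise [IsProbabilityMeasure μ] (H : IsDelayedPricing μ M β₀ m ξ τ p) {s : ℝ} {φ : E × ℝ → ℝ}
    (hφ : Measurable φ) (hsq : ∀ r ∈ M.prices, Integrable (fun e => φ (e, r) ^ 2) M.ν)
    (hmean : ∀ r ∈ M.prices, ∫ e, φ (e, r) ∂M.ν = 0)
    (hle : ∀ r ∈ M.prices, ∫ e, φ (e, r) ^ 2 ∂M.ν ≤ s) :
    PredictableNoise μ M.ν M.prices s φ (pastInfo ξ τ) ξ p where
  meas := hφ
  measS := measurableSet_Icc
  integrable_sq := hsq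
  mean := hmean
  sq_le := hle
  mono := pastInfo_mono
  le := H.pastInfo_le
  ξ_meas t := measurable_random_pastInfo t.lt_succ_self
  law := H.ξ_law
  indep := H.indep_pastInfo
  price_meas t ht := (H.price_meas t ht).mono (H.historyAt_le t) le_rfl
  price_mem := H.price_mem

end IsDelayedPricing

/-- The pricingResidual of an observation `f e p` with mean `h (p(i) ⬝ a)`. -/
noncomputable def pricingResidual (f : E → ℝ → ℝ) (h : ℝ → ℝ) (a : Fin 2 → ℝ) (z : E × ℝ) : ℝ :=
  f z.1 z.2 - h (priceVec z.2 ⬝ᵥ a)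

theorem exists_predictableNoise_residual [IsProbabilityMeasure μ]
    (H : IsDelayedPricing μ M β₀ m ξ τ p)
    {f : E → ℝ → ℝ} {h v : ℝ → ℝ} {σ : ℝ} {a : Fin 2 → ℝ} (hh : Continuous h) (hv : Continuous v)
    (hf : Measurable fun z : E × ℝ => f z.1 z.2)
    (hL2 : ∀ r ∈ M.prices, MemLp (fun e => f e r) 2 M.ν)
    (hmean : ∀ r ∈ M.prices, ∫ e, f e r ∂M.ν = h (a 0 + a 1 * r))
    (hvar : ∀ r ∈ M.prices,
      variance (fun e => f e r) M.ν = σ ^ 2 * v (∫ e, f e r ∂M.ν)) :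
    ∃ s, PredictableNoise μ M.ν M.prices s (pricingResidual f h a) (pastInfo ξ τ) ξ p := by
  have := M.isProb
  have hx : ∀ r, priceVec r ⬝ᵥ a = a 0 + a 1 * r := fun r => by
    rw [priceVec_dotProduct]; ring
  -- The variance is a continuous function of the price, hence bounded on the compact price
  -- interval.
  obtain ⟨s, hs⟩ := (isCompact_Icc (a := M.pl) (b := M.ph)).exists_bound_of_continuousOn
    (f := fun r => σ ^ 2 * v (h (a 0 + a 1 * r))) (by fun_prop)
  refine ⟨s, H.predictableNoise ?_ ?_ ?_ ?_⟩
  · unfold pricingResidual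
    simp only [hx]
    have := hh.measurable
    fun_prop
  · intro r hr
    exact ((hL2 r hr).sub (memLp_const (h (priceVec r ⬝ᵥ a)))).integrable_sq
  · intro r hr
    have h1 := integral_sub ((hL2 r hr).integrable one_le_two)
      (integrable_const (μ := M.ν) (h (priceVec r ⬝ᵥ a)))
    simp only [pricingResidual]
    rw [h1, hmean r hr, hx]
    simp
  · intro r hr
    have h1 := hvar r hr
    rw [variance_eq_integral (hL2 r hr).aestronglyMeasurable.aemeasurable, hmean r hr] at h1
    simp only [pricingResidual, hx]
    rw [h1]
    exact (le_abs_self _).trans (hs r hr)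

end Past

/-! ### Estimation from all but the most recent observations. -/

section PathwiseEstimate

/-- The noise that bounds the estimation error after `t` periods, when observations may be missing
in the last `m` periods only. -/
noncomputable def totalNoise (m : ℕ) (p x : ℕ → ℝ) (t : ℕ) : ℝ :=
  8 * ridgeNoise p x t + 8 * ∑ i ∈ (Finset.Icc 1 t).filter fun i => t < i + m, x i ^ 2

theorem totalNoise_nonneg (m : ℕ) (p x : ℕ → ℝ) (t : ℕ) : 0 ≤ totalNoise m p x t :=
  add_nonneg (mul_nonneg (by norm_num) (ridgeForm_nonneg _ _ _ _))
    (mul_nonneg (by norm_num) (Finset.sum_nonneg fun _ _ => sq_nonneg _))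

/-- Existence and accuracy of the quasi-likelihood estimate from the observations with index in
`J`, when these miss at most the last `m` periods. -/
theorem exists_quasiScore_estimate {h : ℝ → ℝ} (hsm : ContDiff ℝ 2 h)
    (hpos : ∀ s, 0 < deriv h s) (a₀ : Fin 2 → ℝ) (pl ph : ℝ) {ρ : ℝ} (hρ : 0 ≤ ρ) (m : ℕ) :
    ∃ κ > 0, ∃ L₀ > 0, ∀ (p y : ℕ → ℝ) (t : ℕ) (J : Finset ℕ) (L : ℝ), L₀ ≤ L →
      (∀ i, 1 ≤ i → p i ∈ Set.Icc pl ph) → J ⊆ Finset.Icc 1 t →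
      (∀ i ∈ Finset.Icc 1 t, i + m ≤ t → i ∈ J) →
      (∀ v, L * (v ⬝ᵥ v) ≤ ∑ i ∈ Finset.Icc 1 t, (priceVec (p i) ⬝ᵥ v) ^ 2) →
      totalNoise m p (fun i => y i - h (priceVec (p i) ⬝ᵥ a₀)) t < κ * L * ρ →
      (∃ a, quasiScore h J (fun i => priceVec (p i)) y a = 0) ∧
        ∀ a, quasiScore h J (fun i => priceVec (p i)) y a = 0 →
          κ * L * ((a - a₀) ⬝ᵥ (a - a₀)) ≤
            totalNoise m p (fun i => y i - h (priceVec (p i) ⬝ᵥ a₀)) t := by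
  obtain ⟨R, hR⟩ := ((isCompact_Icc (a := pl) (b := ph)).prod
    (isCompact_dotProduct_ball a₀ ρ)).exists_bound_of_continuousOn
    (f := fun z : ℝ × (Fin 2 → ℝ) => priceVec z.1 ⬝ᵥ z.2) (by
      simp only [priceVec_dotProduct]; fun_prop)
  obtain ⟨r, hr⟩ := (isCompact_Icc (a := pl) (b := ph)).exists_bound_of_continuousOn
    (f := fun q : ℝ => 1 + q ^ 2) (by fun_prop)
  have hdc : Continuous (deriv h) := hsm.continuous_deriv (by norm_num)
  have hκ : ∃ κ > 0, ∀ s ∈ Set.Icc (-R) R, κ ≤ deriv h s := by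
    rcases (Set.Icc (-R) R).eq_empty_or_nonempty with he | hne
    · exact ⟨1, one_pos, by simp [he]⟩
    · obtain ⟨z, hz, hmin⟩ := isCompact_Icc.exists_isMinOn hne hdc.continuousOn
      exact ⟨_, hpos z, fun s hs => hmin hs⟩
  obtain ⟨κ, hκ, hderiv⟩ := hκ
  -- The factor `1 / 2` reflects that observed periods keep half of the information. In `L₀`, the
  -- `1` absorbs the ridge identity and `2 * (m * |r|)` the at most `m` missing price vectors.
  refine ⟨κ ^ 2 * (1 / 2), mul_pos (pow_pos hκ 2) one_half_pos, max 1 (2 * (m * |r|)), lt_max_of_lt_left one_pos, ?_⟩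
  intro p y t J L hL hp hJ hJ' hform hnoise
  set x : ℕ → Fin 2 → ℝ := fun i => priceVec (p i) with hx
  set ε : ℕ → ℝ := fun i => y i - h (x i ⬝ᵥ a₀) with hε
  have hL1 : 1 ≤ L := (le_max_left _ _).trans hL
  have hLm : 2 * (m * |r|) ≤ L := (le_max_right _ _).trans hL
  set rest := Finset.Icc 1 t \ J with hrest
  have hrest_mem : ∀ i ∈ rest, 1 ≤ i ∧ i ≤ t ∧ t < i + m := by
    intro i hi
    obtain ⟨h1, h2⟩ := Finset.mem_sdiff.1 hi
    refine ⟨(Finset.mem_Icc.1 h1).1, (Finset.mem_Icc.1 h1).2, ?_⟩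
    by_contra h3
    exact h2 (hJ' i h1 (not_lt.1 h3))
  have hcard : (rest.card : ℝ) ≤ m := by
    have : rest ⊆ Finset.Ico (t + 1 - m) (t + 1) := fun i hi => by
      have := hrest_mem i hi
      rw [Finset.mem_Ico]; lia
    have := Finset.card_le_card this
    rw [Nat.card_Ico] at this
    exact_mod_cast (by lia : rest.card ≤ m)
  have hsplit : ∀ g : ℕ → ℝ,
      ∑ i ∈ Finset.Icc 1 t, g i = ∑ i ∈ rest, g i + ∑ i ∈ J, g i := fun g =>
    (Finset.sum_sdiff hJ).symm
  have hxv : ∀ i ∈ rest, ∀ v, (x i ⬝ᵥ v) ^ 2 ≤ |r| * (v ⬝ᵥ v) := fun i hi v => by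
    have h1 := hr (p i) (hp i (hrest_mem i hi).1)
    rw [Real.norm_of_nonneg (by positivity)] at h1
    have h2 : (x i ⬝ᵥ v) ^ 2 ≤ (1 + p i ^ 2) * (v ⬝ᵥ v) := by
      rw [hx, priceVec_dotProduct]
      simp only [dotProduct, Fin.sum_univ_two]
      nlinarith [sq_nonneg (v 1 - p i * v 0)]
    exact h2.trans (mul_le_mul_of_nonneg_right (h1.trans (le_abs_self r))
      (dotProduct_self_nonneg_real v))
  -- the observed periods carry half of the information
  have hhalf : ∀ v, ∑ i ∈ Finset.Icc 1 t, (x i ⬝ᵥ v) ^ 2 ≤ 2 * ∑ i ∈ J, (x i ⬝ᵥ v) ^ 2 := by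
    intro v
    have h1 : ∑ i ∈ rest, (x i ⬝ᵥ v) ^ 2 ≤ m * |r| * (v ⬝ᵥ v) := by
      refine (Finset.sum_le_card_nsmul _ _ _ fun i hi => hxv i hi v).trans ?_
      rw [nsmul_eq_mul, mul_assoc]
      exact mul_le_mul_of_nonneg_right hcard
        (mul_nonneg (abs_nonneg _) (dotProduct_self_nonneg_real v))
    have h2 := hform v
    have h3 := mul_le_mul_of_nonneg_right hLm (dotProduct_self_nonneg_real v)
    have h4 := hsplit fun i => (x i ⬝ᵥ v) ^ 2
    linarith
  have hB : ∀ v, (∑ i ∈ J, ε i * (x i ⬝ᵥ v)) ^ 2 ≤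
      totalNoise m p ε t * ∑ i ∈ J, (x i ⬝ᵥ v) ^ 2 := by
    intro v
    set P := ∑ i ∈ Finset.Icc 1 t, (x i ⬝ᵥ v) ^ 2 with hP
    have hvP : v ⬝ᵥ v ≤ P := by
      have := hform v
      nlinarith [dotProduct_self_nonneg_real v]
    have hQ0 : 0 ≤ ridgeNoise p ε t := ridgeForm_nonneg _ _ _ _
    have h1 : (∑ i ∈ Finset.Icc 1 t, ε i * (x i ⬝ᵥ v)) ^ 2 ≤ ridgeNoise p ε t * (2 * P) :=
      (sum_noise_sq_le p ε t v).trans (mul_le_mul_of_nonneg_left (by linarith) hQ0)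
    set S := ∑ i ∈ (Finset.Icc 1 t).filter fun i => t < i + m, ε i ^ 2 with hS
    have hS0 : 0 ≤ S := Finset.sum_nonneg fun _ _ => sq_nonneg _
    have h2 : (∑ i ∈ rest, ε i * (x i ⬝ᵥ v)) ^ 2 ≤ S * P := by
      refine (Finset.sum_mul_sq_le_sq_mul_sq rest ε fun i => x i ⬝ᵥ v).trans ?_
      refine mul_le_mul ?_ ?_ (Finset.sum_nonneg fun _ _ => sq_nonneg _) hS0
      · refine Finset.sum_le_sum_of_subset_of_nonneg (fun i hi => ?_) fun _ _ _ => sq_nonneg _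
        have := hrest_mem i hi
        simp only [Finset.mem_filter, Finset.mem_Icc]
        lia
      · exact Finset.sum_le_sum_of_subset_of_nonneg Finset.sdiff_subset fun _ _ _ => sq_nonneg _
    have h3 := hsplit fun i => ε i * (x i ⬝ᵥ v)
    have h4 : ∑ i ∈ J, ε i * (x i ⬝ᵥ v) =
        ∑ i ∈ Finset.Icc 1 t, ε i * (x i ⬝ᵥ v) - ∑ i ∈ rest, ε i * (x i ⬝ᵥ v) := by linarith
    have h5 := hhalf v
    -- From `(a - b)² ≤ 2a² + 2b²`. Passing from `P` to the observed periods doubles the bound to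
    -- `8` and `4`; the `4` is rounded up to `8` in `totalNoise`.
    have h6 : (∑ i ∈ J, ε i * (x i ⬝ᵥ v)) ^ 2 ≤ (4 * ridgeNoise p ε t + 2 * S) * P := by
      rw [h4]
      nlinarith [sq_nonneg (∑ i ∈ Finset.Icc 1 t, ε i * (x i ⬝ᵥ v) +
        ∑ i ∈ rest, ε i * (x i ⬝ᵥ v))]
    refine h6.trans ?_
    have h7 := mul_le_mul_of_nonneg_left h5 (by positivity : 0 ≤ 4 * ridgeNoise p ε t + 2 * S)
    have h8 : 0 ≤ ∑ i ∈ J, (x i ⬝ᵥ v) ^ 2 := Finset.sum_nonneg fun _ _ => sq_nonneg _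
    rw [totalNoise]
    nlinarith [mul_nonneg hS0 h8]
  have hmono : StrictMono h := strictMono_of_deriv_pos hpos
  have hmain := exists_quasiScore_eq_zero (hsm.differentiable (by norm_num)) hmono hκ hderiv
    (I := J) (x := x) (y := y) (a₀ := a₀) (ρ := ρ) (L := L / 2)
    (B := totalNoise m p ε t) (by linarith) (totalNoise_nonneg _ _ _ _) hρ
    (fun i hi a ha => by
      have h1 := hR (p i, a) ⟨hp i (Finset.mem_Icc.1 (hJ hi)).1, ha⟩
      exact abs_le.1 h1)
    (fun v => by
      have := hform v
      have := hhalf v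
      linarith) hB (by linarith)
  refine ⟨hmain.1, fun a ha => ?_⟩
  have := hmain.2 a ha
  linarith

end PathwiseEstimate

/-! ### From the noise to the error of the certainty equivalent price. -/

section Assembly

theorem norm_sq_le_dotProduct_self {ι : Type*} [Fintype ι] (v : ι → ℝ) : ‖v‖ ^ 2 ≤ v ⬝ᵥ v := by
  refine (Real.le_sqrt (norm_nonneg _) (dotProduct_self_nonneg_real v)).1 ?_
  rw [pi_norm_le_iff_of_nonneg (Real.sqrt_nonneg _)]
  refine fun i => Real.abs_le_sqrt ?_
  simp only [dotProduct, ← pow_two]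
  exact Finset.single_le_sum (f := fun i => v i ^ 2) (fun i _ => sq_nonneg _) (Finset.mem_univ i)

theorem norm_priceVec_sub (p q : ℝ) : ‖priceVec p - priceVec q‖ = |p - q| := by
  rw [← Real.norm_eq_abs]
  refine le_antisymm ((pi_norm_le_iff_of_nonneg (norm_nonneg _)).2 fun i => ?_) ?_
  · fin_cases i <;> simp [priceVec]
  · simpa [priceVec] using norm_le_pi_norm (priceVec p - priceVec q) 1

theorem L₁_pos {c : ℝ} (hc : 0 < c) {t : ℕ} (ht : 2 ≤ t) : 0 < L₁ c t := by
  have h2 : (1 : ℝ) < t := by exact_mod_cast ht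
  exact mul_pos hc (Real.sqrt_pos.2 (mul_pos (by linarith) (Real.log_pos h2)))

theorem tendsto_L₁ {c : ℝ} (hc : 0 < c) : Tendsto (L₁ c) atTop atTop := by
  refine Tendsto.const_mul_atTop hc (Real.tendsto_sqrt_atTop.comp ?_)
  exact tendsto_natCast_atTop_atTop.atTop_mul_atTop₀
    (Real.tendsto_log_atTop.comp tendsto_natCast_atTop_atTop)

variable {E : Type*} [MeasurableSpace E] {Ω : Type*} {M : GLMPricingModel E} {β₀ : Param}
  {ξ : ℕ → Ω → E} {τ : ℕ → Ω → ℕ} {p : ℕ → Ω → ℝ}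

theorem demandScore_eq_zero_iff {t : ℕ} {ω : Ω} {a : Fin 2 → ℝ} :
    demandScore M β₀ ξ p t ω a = 0 ↔
      quasiScore M.h₁ (Finset.Icc 1 t) (fun i => priceVec (p i ω))
        (fun i => demandAt M β₀ ξ p i ω) a = 0 := by
  have hσ : 1 / M.σ₁ ^ 2 ≠ 0 := (one_div_pos.2 (pow_pos M.σ₁_pos 2)).ne'
  simp only [demandScore, quasiScore, mul_smul, ← Finset.smul_sum, smul_eq_zero, hσ, false_or]

theorem claimScore_eq_zero_iff {t : ℕ} {ω : Ω} {b : Fin 2 → ℝ} :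
    claimScore M β₀ ξ τ p t ω b = 0 ↔
      quasiScore M.h₂ (observedClaims τ t ω) (fun i => priceVec (p i ω))
        (fun i => Real.log (claimAt M β₀ ξ p i ω)) b = 0 := by
  have hσ : 1 / M.σ₂ ^ 2 ≠ 0 := (one_div_pos.2 (pow_pos M.σ₂_pos 2)).ne'
  simp only [claimScore, quasiScore, mul_smul, ← Finset.smul_sum, smul_eq_zero, hσ, false_or]

/-- The noise of the demands and of the logarithms of the claims, after `t` periods. -/
noncomputable def pricingNoise (M : GLMPricingModel E) (β₀ : Param) (ξ : ℕ → Ω → E)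
    (p : ℕ → Ω → ℝ) (m t : ℕ) (ω : Ω) : ℝ :=
  totalNoise m (fun i => p i ω)
      (fun i => pricingResidual (fun e r => M.D e β₀.1 r) M.h₁ β₀.1 (ξ i ω, p i ω)) t +
    totalNoise m (fun i => p i ω)
      (fun i => pricingResidual (fun e r => Real.log (M.C e β₀.2 r)) M.h₂ β₀.2 (ξ i ω, p i ω)) t

/-- The error of the certainty equivalent price is controlled by the noise. -/
theorem exists_price_error_le (M : GLMPricingModel E) (β₀ : Param) {pOpt : Param → ℝ} {pStar : ℝ}
    {ρ Cl : ℝ} (hρ : 0 < ρ) (hpOpt : ∀ β, pOpt β ∈ M.prices) (hpStar : pStar ∈ M.prices)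
    (hlip : ∀ β ∈ Metric.closedBall β₀ ρ, |pOpt β - pStar| ≤ Cl * ‖β - β₀‖) (m : ℕ) :
    ∃ C > 0, ∃ L₀ > 0, ∀ (ξ : ℕ → Ω → E) (τ : ℕ → Ω → ℕ) (p : ℕ → Ω → ℝ) (t : ℕ) (ω : Ω)
      (L : ℝ) (β : Param), L₀ ≤ L → L ≤ lambdaMin p t ω → (∀ i, τ i ω ≤ m) →
      (∀ i, 1 ≤ i → p i ω ∈ M.prices) →
      ((∃ β, IsMQLE M β₀ ξ τ p t ω β) → IsMQLE M β₀ ξ τ p t ω β) →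
      (pOpt β - pStar) ^ 2 ≤ C * (pricingNoise M β₀ ξ p m t ω / L) := by
  obtain ⟨κ₁, hκ₁, L₁, hL₁, hest₁⟩ := exists_quasiScore_estimate M.h₁_smooth
    (fun s => (M.canonical₁ s).symm ▸ M.v₁_pos s) β₀.1 M.pl M.ph (sq_nonneg ρ) m
  obtain ⟨κ₂, hκ₂, L₂, hL₂, hest₂⟩ := exists_quasiScore_estimate M.h₂_smooth
    (fun s => (M.canonical₂ s).symm ▸ M.v₂_pos s) β₀.2 M.pl M.ph (sq_nonneg ρ) m
  set κ := min κ₁ κ₂ with hκdef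
  have hκ : 0 < κ := lt_min hκ₁ hκ₂
  have hW : 0 < M.ph - M.pl := sub_pos.2 M.pl_lt_ph
  -- The first summand serves the case of small noise; the second serves large noise, where the
  -- noise is at least `κ * L * ρ ^ 2` and the width of the price interval suffices.
  refine ⟨Cl ^ 2 / κ + (M.ph - M.pl) ^ 2 / (κ * ρ ^ 2), by positivity, max L₁ L₂,
    lt_max_of_lt_left hL₁, ?_⟩
  intro ξ τ p t ω L β hL hlam hτ hp hβ
  have hL0 : 0 < L := (lt_max_of_lt_left hL₁).trans_le hL
  have hform := fun v => le_sum_sq_of_le_lambdaMin hlam v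
  specialize hest₁ (fun i => p i ω) (fun i => demandAt M β₀ ξ p i ω) t (Finset.Icc 1 t) L
    ((le_max_left _ _).trans hL) hp subset_rfl (fun i hi _ => hi) hform
  specialize hest₂ (fun i => p i ω) (fun i => Real.log (claimAt M β₀ ξ p i ω)) t
    (observedClaims τ t ω) L ((le_max_right _ _).trans hL) hp (Finset.filter_subset _ _)
    (fun i hi him => Finset.mem_filter.2 ⟨hi, (Nat.add_le_add_left (hτ i) i).trans him⟩) hform
  set N₁ := totalNoise m (fun i => p i ω)
    (fun i => demandAt M β₀ ξ p i ω - M.h₁ (priceVec (p i ω) ⬝ᵥ β₀.1)) t with hN₁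
  set N₂ := totalNoise m (fun i => p i ω)
    (fun i => Real.log (claimAt M β₀ ξ p i ω) - M.h₂ (priceVec (p i ω) ⬝ᵥ β₀.2)) t with hN₂
  have hN : pricingNoise M β₀ ξ p m t ω = N₁ + N₂ := rfl
  have hN₁0 : 0 ≤ N₁ := totalNoise_nonneg _ _ _ _
  have hN₂0 : 0 ≤ N₂ := totalNoise_nonneg _ _ _ _
  rw [hN]
  by_cases hgood : N₁ < κ₁ * L * ρ ^ 2 ∧ N₂ < κ₂ * L * ρ ^ 2
  · obtain ⟨⟨a, ha⟩, hall₁⟩ := hest₁ hgood.1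
    obtain ⟨⟨b, hb⟩, hall₂⟩ := hest₂ hgood.2
    have hM := hβ ⟨(a, b), demandScore_eq_zero_iff.2 ha, claimScore_eq_zero_iff.2 hb⟩
    have h1 := hall₁ β.1 (demandScore_eq_zero_iff.1 hM.1)
    have h2 := hall₂ β.2 (claimScore_eq_zero_iff.1 hM.2)
    have h1n := norm_sq_le_dotProduct_self (β.1 - β₀.1)
    have h2n := norm_sq_le_dotProduct_self (β.2 - β₀.2)
    have h3 : κ₁ * L * ‖β.1 - β₀.1‖ ^ 2 ≤ N₁ :=
      (mul_le_mul_of_nonneg_left h1n (by positivity)).trans h1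
    have h4 : κ₂ * L * ‖β.2 - β₀.2‖ ^ 2 ≤ N₂ :=
      (mul_le_mul_of_nonneg_left h2n (by positivity)).trans h2
    have h5 : ‖β.1 - β₀.1‖ ≤ ρ :=
      (pow_le_pow_iff_left₀ (norm_nonneg _) hρ.le two_ne_zero).1
        (le_of_mul_le_mul_left (h3.trans hgood.1.le) (by positivity))
    have h6 : ‖β.2 - β₀.2‖ ≤ ρ :=
      (pow_le_pow_iff_left₀ (norm_nonneg _) hρ.le two_ne_zero).1
        (le_of_mul_le_mul_left (h4.trans hgood.2.le) (by positivity))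
    have hnorm : ‖β - β₀‖ = max ‖β.1 - β₀.1‖ ‖β.2 - β₀.2‖ := rfl
    have h7 := hlip β (mem_closedBall_iff_norm.2 (by rw [hnorm]; exact max_le h5 h6))
    have h8 : ‖β - β₀‖ ^ 2 ≤ (N₁ + N₂) / (κ * L) := by
      rw [le_div_iff₀ (by positivity), hnorm]
      have h9 : κ * L * ‖β.1 - β₀.1‖ ^ 2 ≤ N₁ := le_trans (by
        gcongr; exact min_le_left _ _) h3
      have h10 : κ * L * ‖β.2 - β₀.2‖ ^ 2 ≤ N₂ := le_trans (by
        gcongr; exact min_le_right _ _) h4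
      rcases max_choice ‖β.1 - β₀.1‖ ‖β.2 - β₀.2‖ with h | h <;> rw [h] <;> linarith
    calc (pOpt β - pStar) ^ 2 = |pOpt β - pStar| ^ 2 := (sq_abs _).symm
      _ ≤ (Cl * ‖β - β₀‖) ^ 2 := pow_le_pow_left₀ (abs_nonneg _) h7 2
      _ = Cl ^ 2 * ‖β - β₀‖ ^ 2 := by ring
      _ ≤ Cl ^ 2 * ((N₁ + N₂) / (κ * L)) := by gcongr
      _ = Cl ^ 2 / κ * ((N₁ + N₂) / L) := by field_simp
      _ ≤ _ := by
        refine mul_le_mul_of_nonneg_right (le_add_of_nonneg_right ?_) ?_ <;> positivity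
  · have h1 : κ * L * ρ ^ 2 ≤ N₁ + N₂ := by
      rw [not_and_or, not_lt, not_lt] at hgood
      rcases hgood with h | h
      · have : κ * L * ρ ^ 2 ≤ κ₁ * L * ρ ^ 2 := by gcongr; exact min_le_left _ _
        linarith
      · have : κ * L * ρ ^ 2 ≤ κ₂ * L * ρ ^ 2 := by gcongr; exact min_le_right _ _
        linarith
    have h2 : (pOpt β - pStar) ^ 2 ≤ (M.ph - M.pl) ^ 2 := by
      have h3 := hpOpt β
      refine sq_le_sq' ?_ ?_ <;> linarith [h3.1, h3.2, hpStar.1, hpStar.2]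
    calc (pOpt β - pStar) ^ 2 ≤ (M.ph - M.pl) ^ 2 * 1 := by linarith
      _ ≤ (M.ph - M.pl) ^ 2 * ((N₁ + N₂) / (κ * L * ρ ^ 2)) := by
        gcongr
        rwa [one_le_div (by positivity)]
      _ = (M.ph - M.pl) ^ 2 / (κ * ρ ^ 2) * ((N₁ + N₂) / L) := by field_simp
      _ ≤ _ := by
        refine mul_le_mul_of_nonneg_right (le_add_of_nonneg_left ?_) ?_ <;> positivity

variable [MeasurableSpace Ω] {μ : Measure Ω} [IsProbabilityMeasure μ]

theorem PredictableNoise.exists_totalNoise_le {ν : Measure E} [IsProbabilityMeasure ν]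
    {S : Set ℝ} {s : ℝ} {φ : E × ℝ → ℝ} {𝒢 : ℕ → MeasurableSpace Ω}
    (H : PredictableNoise μ ν S s φ 𝒢 ξ p) (hS : Bornology.IsBounded S) (m : ℕ) :
    ∃ C ≥ 0, ∀ t, 2 ≤ t →
      Integrable (fun ω => totalNoise m (fun i => p i ω) (fun i => φ (ξ i ω, p i ω)) t) μ ∧
      ∫ ω, totalNoise m (fun i => p i ω) (fun i => φ (ξ i ω, p i ω)) t ∂μ ≤ C * Real.log t := by
  obtain ⟨R, hR⟩ := hS.exists_norm_le
  have hr : ∀ q ∈ S, q ^ 2 ≤ R ^ 2 := fun q hq => by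
    rw [← sq_abs]; exact pow_le_pow_left₀ (abs_nonneg _) (hR q hq) 2
  have hs := H.var_nonneg
  have hlog2 : 0 < Real.log 2 := Real.log_pos one_lt_two
  have hlogR : 0 ≤ Real.log (1 + R ^ 2) := Real.log_nonneg (by nlinarith [sq_nonneg R])
  -- For `t ≥ 2`, `(1 + t)(1 + t R²) ≤ t³ (1 + R²)` gives the `3`; the divisions by `log 2` turn
  -- constants into multiples of `log t`.
  refine ⟨8 * (s * (3 + Real.log (1 + R ^ 2) / Real.log 2)) + 8 * (m * s / Real.log 2),
    by positivity, fun t ht => ?_⟩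
  obtain ⟨hi1, -⟩ := H.integrable_ridgeNoise_and_le hr t
  obtain ⟨hi2, hle2⟩ := H.recent_noise m t
  have hle1 := H.integral_ridgeNoise_le hr t
  refine ⟨(hi1.const_mul 8).add (hi2.const_mul 8), ?_⟩
  have ht2 : (2 : ℝ) ≤ t := by exact_mod_cast ht
  have hlogt : Real.log 2 ≤ Real.log t := Real.log_le_log two_pos ht2
  have h1 : Real.log ((1 + t) * (1 + t * R ^ 2)) ≤
      (3 + Real.log (1 + R ^ 2) / Real.log 2) * Real.log t := by
    have h2 : Real.log ((1 + t) * (1 + t * R ^ 2)) ≤ Real.log ((t : ℝ) ^ 3 * (1 + R ^ 2)) := by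
      refine Real.log_le_log (by positivity) ?_
      have h3 : (1 + t : ℝ) ≤ t ^ 2 := by nlinarith
      have h4 : (1 + t * R ^ 2 : ℝ) ≤ t * (1 + R ^ 2) := by nlinarith
      calc (1 + t : ℝ) * (1 + t * R ^ 2) ≤ t ^ 2 * (t * (1 + R ^ 2)) := by gcongr
        _ = _ := by ring
    rw [Real.log_mul (x := (t : ℝ) ^ 3) (by positivity) (by positivity), Real.log_pow] at h2
    have h5 : Real.log (1 + R ^ 2) ≤ Real.log (1 + R ^ 2) / Real.log 2 * Real.log t := by
      rw [div_mul_eq_mul_div, le_div_iff₀ hlog2]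
      gcongr
    push_cast at h2
    linarith
  have h6 : m * s ≤ m * s / Real.log 2 * Real.log t := by
    rw [div_mul_eq_mul_div, le_div_iff₀ hlog2]
    gcongr
  have h7 := mul_le_mul_of_nonneg_left h1 hs
  have hsum := integral_add (hi1.const_mul 8) (hi2.const_mul 8)
  rw [integral_const_mul, integral_const_mul] at hsum
  simp only [totalNoise]
  rw [hsum]
  linarith

theorem IsDelayedPricing.exists_pricingNoise_le {m : ℕ} (H : IsDelayedPricing μ M β₀ m ξ τ p) :
    ∃ C ≥ 0, ∀ t, 2 ≤ t → Integrable (pricingNoise M β₀ ξ p m t) μ ∧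
      ∫ ω, pricingNoise M β₀ ξ p m t ω ∂μ ≤ C * Real.log t := by
  have := M.isProb
  obtain ⟨s₁, hs₁⟩ := exists_predictableNoise_residual H
    (f := fun e r => M.D e β₀.1 r) M.h₁_smooth.continuous M.v₁_smooth.continuous
    (M.D_meas _) (M.D_memLp _) (M.D_mean _) (M.D_var _)
  obtain ⟨s₂, hs₂⟩ := exists_predictableNoise_residual H
    (f := fun e r => Real.log (M.C e β₀.2 r)) M.h₂_smooth.continuous M.v₂_smooth.continuous
    (Real.measurable_log.comp (M.C_meas _)) (M.logC_memLp _) (M.logC_mean _) (M.logC_var _)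
  obtain ⟨C₁, hC₁, h₁⟩ := hs₁.exists_totalNoise_le (Metric.isBounded_Icc _ _) m
  obtain ⟨C₂, hC₂, h₂⟩ := hs₂.exists_totalNoise_le (Metric.isBounded_Icc _ _) m
  refine ⟨C₁ + C₂, add_nonneg hC₁ hC₂, fun t ht => ⟨(h₁ t ht).1.add (h₂ t ht).1, ?_⟩⟩
  have hsum := integral_add (h₁ t ht).1 (h₂ t ht).1
  simp only [pricingNoise]
  rw [hsum, add_mul]
  exact add_le_add (h₁ t ht).2 (h₂ t ht).2

end Assembly

/-! ### The regret bound. -/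

theorem theorem3 {E : Type*} [MeasurableSpace E] {Ω : Type*} [MeasurableSpace Ω]
    (μ : Measure Ω) [IsProbabilityMeasure μ]
    -- the model, the true parameter, and the map `β ↦ p(β)`
    (M : GLMPricingModel E) (β₀ : Param) (pOpt : Param → ℝ) (hpOpt : M.IsOptimalPriceMap pOpt)
    -- near the true parameter the optimal price is unique and the revenue is smooth
    (V : Set Param) (hV : IsOpen V) (hVb : Bornology.IsBounded V) (hβ₀ : β₀ ∈ V)
    (hunique : ∀ β ∈ V, ∃! q, M.IsOptimalPrice β q)
    (hsmooth : ContDiffOn ℝ 2 (fun q : ℝ × Param => M.revenue q.1 q.2) (M.prices ×ˢ V))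
    (hfirst : derivWithin (fun p => M.revenue p β₀) M.prices (pOpt β₀) = 0)
    (hsecond : iteratedDerivWithin 2 (fun p => M.revenue p β₀) M.prices (pOpt β₀) < 0)
    -- prices, demands and delayed claims
    (m : ℕ) (ξ : ℕ → Ω → E) (τ : ℕ → Ω → ℕ) (p : ℕ → Ω → ℝ)
    (hproc : IsDelayedPricing μ M β₀ m ξ τ p)
    -- the maximum quasi-likelihood estimator, a solution whenever one exists
    (βhat : ℕ → Ω → Param)
    (hMQLE : ∀ᵐ ω ∂μ, ∀ t, 1 ≤ t → (∃ β, IsMQLE M β₀ ξ τ p t ω β) →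
      IsMQLE M β₀ ξ τ p t ω (βhat t ω))
    (hconsistent : ∀ᵐ ω ∂μ, Tendsto (fun t => βhat t ω) atTop (𝓝 β₀))
    -- price dispersion, and closeness to the certainty equivalent prices (the price vectors have
    -- the same first entry, so every norm of their difference is the distance of the prices)
    (t₀ : ℕ) (c : ℝ) (hc : 0 < c) (K : ℝ) (hK : 0 < K)
    (hdisp : ∀ᵐ ω ∂μ, ∀ t, t₀ ≤ t → L₁ c t ≤ lambdaMin p t ω)
    (hcep : ∀ᵐ ω ∂μ, ∀ T, t₀ ≤ T →
      ∑ t ∈ Finset.Icc 1 T, ‖priceVec (p t ω) - priceVec (pOpt (βhat t ω))‖ ^ 2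
        ≤ (2 * m + K) * L₁ c T) :
    (∀ T, Integrable (revenueLoss M β₀ (pOpt β₀) p T) μ) ∧
      (fun T : ℕ => regret μ M β₀ (pOpt β₀) p T) =O[atTop]
        (fun T : ℕ => L₁ c T + ∑ t ∈ Finset.Icc 2 T, Real.log t / L₁ c t) := by
  set q := pOpt β₀ with hq
  have hstar : M.IsOptimalPrice β₀ q := (hpOpt β₀).2 (hunique β₀ hβ₀).exists
  have hprob := M.isProb
  -- the revenue near the optimal price
  have hf : ContDiffOn ℝ 2 (fun r => M.revenue r β₀) M.prices :=
    hsmooth.comp (g := fun z : ℝ × Param => M.revenue z.1 z.2) (f := fun r : ℝ => (r, β₀))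
      (contDiff_id.prodMk contDiff_const).contDiffOn fun r hr => Set.mk_mem_prod hr hβ₀
  obtain ⟨k, hk, C₁, hC₁, hquad⟩ := exists_sq_bounds_of_unique_max (f := fun r => M.revenue r β₀)
    (a := M.pl) (b := M.ph) hstar.1 hf (fun x hx hxq => by
      refine lt_of_le_of_ne (hstar.2 hx) fun heq => hxq ((hunique β₀ hβ₀).unique ⟨hx, ?_⟩ hstar)
      intro y hy
      exact (hstar.2 hy).trans_eq heq.symm) hfirst hsecond
  obtain ⟨ρ, hρ, Cl, hCl, hball, hlip⟩ := exists_lipschitz_maximizer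
    (F := fun z : ℝ × Param => M.revenue z.1 z.2) M.pl_lt_ph hV hβ₀ hsmooth hk hstar.1
    (fun x hx => (hquad x hx).1)
  -- The closed ball lies in `V`, where a maximizer exists; hence `pOpt β` does maximize there and
  -- the Lipschitz bound applies to it.
  obtain ⟨C₂, hC₂, L₀, hL₀, herr⟩ := exists_price_error_le (Ω := Ω) M β₀ (pOpt := pOpt) hρ
    (fun β => (hpOpt β).1) hstar.1 (fun β hβ => hlip β hβ _ (hpOpt β).1
      (((hpOpt β).2 (hunique β (hball hβ)).exists).2 hstar.1)) m
  obtain ⟨C₃, hC₃, hnoise⟩ := hproc.exists_pricingNoise_le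
  -- the loss is measurable and bounded
  have hloss_nonneg : ∀ T ω, 0 ≤ revenueLoss M β₀ q p T ω := fun T ω =>
    Finset.sum_nonneg fun t ht =>
      sub_nonneg.2 (hstar.2 (hproc.price_mem t (Finset.mem_Icc.1 ht).1 ω))
  have hrev : Measurable fun r => M.revenue r β₀ := by
    refine (StronglyMeasurable.integral_prod_right
      (f := fun r e => r * M.D e β₀.1 r - M.C e β₀.2 r) ?_).measurable
    have h1 := (M.D_meas β₀.1).comp (measurable_swap (α := ℝ) (β := E))
    have h2 := (M.C_meas β₀.2).comp (measurable_swap (α := ℝ) (β := E))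
    exact ((measurable_fst.mul h1).sub h2).stronglyMeasurable
  have hpm : ∀ t, 1 ≤ t → Measurable (p t) := fun t ht =>
    (hproc.price_meas t ht).mono ((hproc.historyAt_le t).trans (hproc.pastInfo_le t)) le_rfl
  have hloss_le : ∀ T ω, revenueLoss M β₀ q p T ω ≤
      C₁ * ∑ t ∈ Finset.Icc 1 T, (p t ω - q) ^ 2 := fun T ω => by
    rw [revenueLoss, Finset.mul_sum]
    exact Finset.sum_le_sum fun t ht =>
      (hquad _ (hproc.price_mem t (Finset.mem_Icc.1 ht).1 ω)).2
  have hW : ∀ x ∈ M.prices, (x - q) ^ 2 ≤ (M.ph - M.pl) ^ 2 := fun x hx => by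
    have h := hstar.1
    refine sq_le_sq' ?_ ?_ <;> linarith [hx.1, hx.2, h.1, h.2]
  have hint : ∀ T, Integrable (revenueLoss M β₀ q p T) μ := fun T => by
    refine Integrable.of_bound (C := C₁ * ∑ t ∈ Finset.Icc 1 T, (M.ph - M.pl) ^ 2) ?_
      (ae_of_all _ fun ω => ?_)
    · exact (Finset.measurable_fun_sum _ fun t ht => measurable_const.sub
        (hrev.comp (hpm t (Finset.mem_Icc.1 ht).1))).aestronglyMeasurable
    · rw [Real.norm_of_nonneg (hloss_nonneg T ω)]
      refine (hloss_le T ω).trans (mul_le_mul_of_nonneg_left ?_ hC₁.le)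
      exact Finset.sum_le_sum fun t ht =>
        hW _ (hproc.price_mem t (Finset.mem_Icc.1 ht).1 ω)
  refine ⟨hint, ?_⟩
  -- Before `t₁` the crude width bound is used, which costs only a constant. The requirement `1 ≤ L₁
  -- c t` lets `L₁ c T` absorb that constant at the end.
  obtain ⟨t₁, ht₁⟩ := eventually_atTop.1 (((tendsto_L₁ hc).eventually_ge_atTop (max L₀ 1)).and
    ((eventually_ge_atTop t₀).and (eventually_ge_atTop 2)))
  have ht₁L : ∀ t, t₁ ≤ t → L₀ ≤ L₁ c t ∧ 1 ≤ L₁ c t ∧ t₀ ≤ t ∧ 2 ≤ t := fun t ht =>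
    ⟨(le_max_left _ _).trans (ht₁ t ht).1, (le_max_right _ _).trans (ht₁ t ht).1,
      (ht₁ t ht).2.1, (ht₁ t ht).2.2⟩
  have hτ : ∀ᵐ ω ∂μ, ∀ t, τ t ω ≤ m := ae_all_iff.2 hproc.τ_le
  set N := pricingNoise M β₀ ξ p m with hN
  set bound : ℕ → Ω → ℝ := fun T ω => 2 * C₁ * ((2 * m + K) * L₁ c T +
    t₁ * (M.ph - M.pl) ^ 2 + ∑ t ∈ Finset.Icc t₁ T, C₂ / L₁ c t * N t ω) with hbound
  have hle : ∀ T, t₁ ≤ T → ∀ᵐ ω ∂μ, revenueLoss M β₀ q p T ω ≤ bound T ω := by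
    intro T hT
    filter_upwards [hτ, hMQLE, hdisp, hcep] with ω hτω hMω hdω hcω
    have h1 := hcω T (ht₁L T hT).2.2.1
    simp only [norm_priceVec_sub, sq_abs] at h1
    have h2 : ∑ t ∈ Finset.Icc 1 T, (pOpt (βhat t ω) - q) ^ 2 ≤
        t₁ * (M.ph - M.pl) ^ 2 + ∑ t ∈ Finset.Icc t₁ T, C₂ / L₁ c t * N t ω := by
      rw [← Finset.sum_filter_add_sum_filter_not (Finset.Icc 1 T) (fun t => t < t₁)]
      refine add_le_add ?_ ?_
      · refine (Finset.sum_le_card_nsmul _ _ ((M.ph - M.pl) ^ 2)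
          fun t _ => hW _ (hpOpt _).1).trans ?_
        rw [nsmul_eq_mul]
        refine mul_le_mul_of_nonneg_right ?_ (sq_nonneg _)
        have h3 : ((Finset.Icc 1 T).filter fun t => t < t₁) ⊆ Finset.range t₁ := fun t ht =>
          Finset.mem_range.2 (Finset.mem_filter.1 ht).2
        exact_mod_cast (Finset.card_le_card h3).trans_eq (Finset.card_range t₁)
      · have h3 : ((Finset.Icc 1 T).filter fun t => ¬ t < t₁) = Finset.Icc t₁ T := by
          have := (ht₁L t₁ le_rfl).2.2.2
          ext t
          simp only [Finset.mem_filter, Finset.mem_Icc]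
          lia
        rw [h3]
        refine Finset.sum_le_sum fun t ht => ?_
        have h4 := ht₁L t (Finset.mem_Icc.1 ht).1
        refine (herr ξ τ p t ω (L₁ c t) (βhat t ω) h4.1 (hdω t h4.2.2.1) hτω
          (fun i hi => hproc.price_mem i hi ω) (hMω t (by lia))).trans_eq ?_
        rw [hN]
        ring
    have h3 : ∑ t ∈ Finset.Icc 1 T, (p t ω - q) ^ 2 ≤
        2 * ∑ t ∈ Finset.Icc 1 T, (p t ω - pOpt (βhat t ω)) ^ 2 +
          2 * ∑ t ∈ Finset.Icc 1 T, (pOpt (βhat t ω) - q) ^ 2 := by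
      rw [Finset.mul_sum, Finset.mul_sum, ← Finset.sum_add_distrib]
      refine Finset.sum_le_sum fun t _ => ?_
      nlinarith [sq_nonneg ((p t ω - pOpt (βhat t ω)) - (pOpt (βhat t ω) - q))]
    refine (hloss_le T ω).trans ?_
    simp only [hbound]
    rw [mul_comm 2 C₁, mul_assoc]
    refine mul_le_mul_of_nonneg_left ?_ hC₁.le
    linarith
  have hterm : ∀ T, ∀ t ∈ Finset.Icc t₁ T, Integrable (fun ω => C₂ / L₁ c t * N t ω) μ :=
    fun T t ht => (hnoise t (ht₁L t (Finset.mem_Icc.1 ht).1).2.2.2).1.const_mul _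
  have hregret : ∀ T, t₁ ≤ T → regret μ M β₀ q p T ≤
      2 * C₁ * ((2 * m + K) * L₁ c T + t₁ * (M.ph - M.pl) ^ 2 +
        C₂ * C₃ * ∑ t ∈ Finset.Icc 2 T, Real.log t / L₁ c t) := by
    intro T hT
    have hsumint := integrable_finsetSum (Finset.Icc t₁ T) (hterm T)
    have hbint : Integrable (bound T) μ := ((integrable_const _).add hsumint).const_mul _
    refine (integral_mono_ae (hint T) hbint (hle T hT)).trans ?_
    have h1 : ∫ ω, bound T ω ∂μ = 2 * C₁ * ((2 * m + K) * L₁ c T + t₁ * (M.ph - M.pl) ^ 2 +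
        ∑ t ∈ Finset.Icc t₁ T, C₂ / L₁ c t * ∫ ω, N t ω ∂μ) := by
      simp only [hbound]
      rw [integral_const_mul, integral_add (integrable_const _) hsumint, integral_const,
        integral_finsetSum _ (hterm T)]
      simp [integral_const_mul]
    rw [h1]
    gcongr
    rw [Finset.mul_sum]
    calc ∑ t ∈ Finset.Icc t₁ T, C₂ / L₁ c t * ∫ ω, N t ω ∂μ
        ≤ ∑ t ∈ Finset.Icc t₁ T, C₂ * C₃ * (Real.log t / L₁ c t) := by
          refine Finset.sum_le_sum fun t ht => ?_
          have h4 := ht₁L t (Finset.mem_Icc.1 ht).1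
          have h5 : 0 < L₁ c t := one_pos.trans_le h4.2.1
          calc C₂ / L₁ c t * ∫ ω, N t ω ∂μ ≤ C₂ / L₁ c t * (C₃ * Real.log t) := by
                gcongr
                exact (hnoise t h4.2.2.2).2
            _ = _ := by ring
      _ ≤ ∑ t ∈ Finset.Icc 2 T, C₂ * C₃ * (Real.log t / L₁ c t) := by
          refine Finset.sum_le_sum_of_subset_of_nonneg
            (Finset.Icc_subset_Icc_left (ht₁L t₁ le_rfl).2.2.2) fun t ht _ => ?_
          have h5 := L₁_pos hc (Finset.mem_Icc.1 ht).1
          have h6 : 0 ≤ Real.log t := Real.log_natCast_nonneg t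
          positivity
  refine Asymptotics.IsBigO.of_bound
    (2 * C₁ * ((2 * m + K) + t₁ * (M.ph - M.pl) ^ 2 + C₂ * C₃)) ?_
  filter_upwards [eventually_ge_atTop t₁] with T hT
  have hreg0 : 0 ≤ regret μ M β₀ q p T := integral_nonneg (hloss_nonneg T)
  have hsum0 : 0 ≤ ∑ t ∈ Finset.Icc 2 T, Real.log t / L₁ c t :=
    Finset.sum_nonneg fun t ht =>
      div_nonneg (Real.log_natCast_nonneg t) (L₁_pos hc (Finset.mem_Icc.1 ht).1).le
  have hL1 := (ht₁L T hT).2.1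
  rw [Real.norm_of_nonneg hreg0, Real.norm_of_nonneg (by linarith)]
  refine (hregret T hT).trans ?_
  rw [mul_assoc (2 * C₁)]
  refine mul_le_mul_of_nonneg_left ?_ (by positivity)
  have hA : 0 ≤ (2 * m + K) := by positivity
  have hB : 0 ≤ t₁ * (M.ph - M.pl) ^ 2 := by positivity
  have hD : 0 ≤ C₂ * C₃ := by positivity
  nlinarith [mul_nonneg hA hsum0, mul_nonneg hB hsum0, mul_nonneg hD (zero_le_one.trans hL1),
    mul_nonneg hB (sub_nonneg.2 hL1)]
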